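/- **Setting.** Let $\Theta=(\theta_k)_{k\ge1}$ be a sequence of strictly positive reals. On the symmetric group $S_N$ let $\mathbb P_\Theta$ be the generalized Ewens measure $\mathbb P_\Theta[\sigma]=\frac1{h_NN!}\prod_{k=1}^N\theta_k^{C_k(\sigma)}$, where $C_k(\sigma)$ is the number of cycles of length $k$ of $\sigma$ and $h_N$ is the normalization constant. Let $\sigma$ have law $\mathbb P_\Theta$, and let $z_1,\dots,z_N$ be i.i.d. random variables on the unit circle $S^1$ with an arbitrary common law $\nu$ (the same for all $N$), independent of $\sigma$. Let $M=\operatorname{diag}(z_1,\dots,z_N)\,(\delta_{i,\sigma(j)})_{i,j}$. For a measurable function $F:S^1\to\mathbb C$ let $\mathrm{tr}(F)=\sum_{k=1}^NF(\omega_k)$, where $\omega_1,\dots,\omega_N$ are the eigenvalues of $M$ with multiplicity. Put $\Delta_k(F,y)=\frac1k\sum_{\omega^k=y}F(\omega)$, and for $k,m\ge1$ let $Z_{k,m}$ be independent random variables with $Z_{k,m}$ distributed as $\prod_{j=1}^kz_j$, where $z_1,\dots,z_k$ are i.i.d. with law $\nu$. The characteristic function of a complex random variable $X$ is $\varphi_X(s)=\mathbb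 E[e^{i\,\mathrm{Re}(\bar sX)}]$, $s\in\mathbb C$ (so $\varphi_X(s)=\mathbb E[e^{isX}]$ if $X$ is real valued and $s\in\mathbb R$). Let $\chi_k$ be the characteristic function of $k\Delta_k(F,Z_{k,1})$. For $r>0$, $\vartheta\ge0$, $0<\gamma\le1$, a power series $g$ belongs to $e\mathcal F(r,\vartheta,\gamma)$ if it converges to a holomorphic function on $|t|<r$ and $g(t)=\vartheta\log\frac1{1-t/r}+g_0(t)$ there, where the coefficients of $g_0$ satisfy $[t^N][g_0]=O(r^{-N}N^{-1-\gamma})$. Let $g_\Theta(t)=\sum_{k\ge1}\frac{\theta_k}kt^k$ and $g_{\mathrm{tr}(F)}(t)=\sum_{k\ge1}\frac{\theta_k}k\chi_k(s)t^k$. **Theorem.** Assume that $\mathbb E|\Delta_k(F,Z_{k,1})|=O(k^{-1-\delta})$ as $k\to\infty$ for some $0<\delta\le1$, and that $g_\Theta\in e\mathcal F(r,\vartheta,\gamma)$ with $r>0$, $\vartheta\ge0$, $0<\gamma\le1$. Then: 1. For every $s\in\mathbb C$, $g_{\mathrm{tr}(F)}\in e\mathcal F(r,\vartheta,\min\{\gamma,\delta\})$,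 and the series $\sum_{k\ge1}\frac{\theta_k}k(\chi_k(s)-1)r^k$ converges absolutely. 2. If $\vartheta>0$, then for every fixed $s\in\mathbb C$, as $N\to\infty$, $$\varphi_{\mathrm{tr}(F)}(s)=\exp\Bigl(\sum_{k=1}^\infty\frac{\theta_k}k(\chi_k(s)-1)r^k\Bigr)+O\bigl(N^{-\min\{\gamma,\delta\}}\log N\bigr).$$ 3. Let $(P_k)_{k\ge1}$ be independent Poisson random variables, $P_k$ with parameter $\theta_kr^k/k$, independent of $(Z_{k,m})_{k,m\ge1}$. Then the series $Y=\sum_{k=1}^\infty\sum_{m=1}^{P_k}k\Delta_k(F,Z_{k,m})$ is almost surely absolutely convergent, and, if $\vartheta>0$, $\mathrm{tr}(F)$ converges in law to $Y$ as $N\to\infty$. -/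

import Mathlib

open MeasureTheory ProbabilityTheory Filter Topology Asymptotics
open scoped BigOperators Nat

noncomputable section

namespace WreathTrace

/-- The unit circle carries its Borel sigma-algebra. -/
instance instMeasurableSpaceCircle : MeasurableSpace Circle := borel Circle

instance instBorelSpaceCircle : BorelSpace Circle := ⟨rfl⟩

/-- The finite symmetric group carries the discrete sigma-algebra. -/
instance instMeasurableSpacePerm (N : ℕ) : MeasurableSpace (Equiv.Perm (Fin N)) := ⊤

/-! ### The generalized Ewens measure -/

/-- `C_k(σ)`: the number of cycles of length `k` of `σ`
(fixed points are cycles of length one). -/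
def cycleCount {N : ℕ} (σ : Equiv.Perm (Fin N)) (k : ℕ) : ℕ :=
  σ.partition.parts.count k

/-- The weight `∏_{k=1}^N θ_k ^ C_k(σ)`. -/
def ewensWeight (θ : ℕ → ℝ) {N : ℕ} (σ : Equiv.Perm (Fin N)) : ℝ :=
  ∏ k ∈ Finset.Icc 1 N, θ k ^ cycleCount σ k

/-- The normalization constant `h_N = (1 / N!) ∑_σ ∏_k θ_k ^ C_k(σ)`. -/
def ewensNorm (θ : ℕ → ℝ) (N : ℕ) : ℝ :=
  (1 / (N ! : ℝ)) * ∑ σ : Equiv.Perm (Fin N), ewensWeight θ σ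

/-- The generalized Ewens measure on the symmetric group:
`σ` has probability `(1 / (h_N N!)) ∏_k θ_k ^ C_k(σ)`. -/
def ewensMeasure (θ : ℕ → ℝ) (N : ℕ) : Measure (Equiv.Perm (Fin N)) :=
  ∑ σ : Equiv.Perm (Fin N),
    ENNReal.ofReal (1 / (ewensNorm θ N * (N ! : ℝ)) * ewensWeight θ σ) • Measure.dirac σ

theorem ewensWeight_pos {θ : ℕ → ℝ} (hθ : ∀ k, 1 ≤ k → 0 < θ k) {N : ℕ}
    (σ : Equiv.Perm (Fin N)) : 0 < ewensWeight θ σ :=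
  Finset.prod_pos fun k hk => pow_pos (hθ k (Finset.mem_Icc.1 hk).1) _

theorem isProbabilityMeasure_ewensMeasure {θ : ℕ → ℝ} (hθ : ∀ k, 1 ≤ k → 0 < θ k) (N : ℕ) :
    IsProbabilityMeasure (ewensMeasure θ N) := by
  have hS : 0 < ∑ σ : Equiv.Perm (Fin N), ewensWeight θ σ :=
    Finset.sum_pos (fun σ _ => ewensWeight_pos hθ σ) Finset.univ_nonempty
  have hN : (0 : ℝ) < (N ! : ℝ) := by exact_mod_cast Nat.factorial_pos N
  have hn : ewensNorm θ N * (N ! : ℝ) = ∑ σ : Equiv.Perm (Fin N), ewensWeight θ σ := by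
    unfold ewensNorm
    field_simp
  constructor
  simp only [ewensMeasure, Measure.coe_finsetSum, Finset.sum_apply, Measure.smul_apply,
    measure_univ, smul_eq_mul, mul_one]
  rw [← ENNReal.ofReal_sum_of_nonneg, ← Finset.mul_sum, hn, one_div_mul_cancel hS.ne',
    ENNReal.ofReal_one]
  intro σ _
  rw [hn]
  exact mul_nonneg (by positivity) (ewensWeight_pos hθ σ).le

/-! ### Random matrices in the wreath product of the circle with the symmetric group -/

/-- The law of `(σ, z_1, …, z_N)`: the permutation `σ` follows the generalized Ewens measure,
`z_1, …, z_N` are i.i.d. with law `ν` on the circle, and `σ` is independent of them. -/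
def wreathMeasure (θ : ℕ → ℝ) (ν : Measure Circle) (N : ℕ) :
    Measure (Equiv.Perm (Fin N) × (Fin N → Circle)) :=
  (ewensMeasure θ N).prod (Measure.pi fun _ => ν)

theorem isProbabilityMeasure_wreathMeasure {θ : ℕ → ℝ} (hθ : ∀ k, 1 ≤ k → 0 < θ k)
    (ν : Measure Circle) [IsProbabilityMeasure ν] (N : ℕ) :
    IsProbabilityMeasure (wreathMeasure θ ν N) := by
  have := isProbabilityMeasure_ewensMeasure hθ N
  unfold wreathMeasure
  infer_instance

/-- The matrix `M(σ, z_1, …, z_N) = diag(z_1, …, z_N) · (δ_{i, σ(j)})_{i, j}`. -/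
def wreathMatrix {N : ℕ} (x : Equiv.Perm (Fin N) × (Fin N → Circle)) :
    Matrix (Fin N) (Fin N) ℂ :=
  Matrix.diagonal (fun i => (x.2 i : ℂ)) *
    Matrix.of (fun i j => if i = x.1 j then (1 : ℂ) else 0)

/-- The trace of a function: `tr(F) = ∑_{k=1}^N F(ω_k)`, the sum over the eigenvalues of
`M(σ, z_1, …, z_N)`, each counted with its multiplicity as a root of the characteristic
polynomial. All the eigenvalues lie on the circle, see `norm_eq_one_of_mem_roots`. -/
def wreathTrace (F : Circle → ℂ) {N : ℕ} (x : Equiv.Perm (Fin N) × (Fin N → Circle)) : ℂ :=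
  ∑ᶠ ω : Circle, ((wreathMatrix x).charpoly.rootMultiplicity (ω : ℂ) : ℂ) * F ω

theorem norm_eq_one_of_mem_roots {N : ℕ} (x : Equiv.Perm (Fin N) × (Fin N → Circle)) {μ : ℂ}
    (hμ : μ ∈ (wreathMatrix x).charpoly.roots) : ‖μ‖ = 1 := by
  have hroot : (wreathMatrix x).charpoly.IsRoot μ := (Polynomial.mem_roots'.1 hμ).2
  rw [Polynomial.IsRoot, Matrix.eval_charpoly] at hroot
  obtain ⟨v, hv0, hv⟩ := Matrix.exists_mulVec_eq_zero_iff.2 hroot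
  have key : ∀ i, μ * v (x.1 i) = (x.2 (x.1 i) : ℂ) * v i := by
    intro i
    have h := congrFun hv (x.1 i)
    simpa [Matrix.sub_mulVec, wreathMatrix, ← Matrix.mulVec_mulVec, Matrix.mulVec_diagonal,
      Matrix.mulVec, dotProduct, Matrix.diagonal_apply, Matrix.scalar_apply, sub_mul,
      Finset.sum_sub_distrib, ite_mul, sub_eq_zero] using h
  have hnorm : ∀ i, ‖μ‖ * ‖v (x.1 i)‖ = ‖v i‖ := by
    intro i
    have h := congrArg norm (key i)
    rwa [norm_mul, norm_mul, Circle.norm_coe, one_mul] at h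
  have hsum : ‖μ‖ * ∑ i, ‖v i‖ = ∑ i, ‖v i‖ := by
    rw [← Equiv.sum_comp x.1 (fun i => ‖v i‖), Finset.mul_sum]
    rw [Finset.sum_congr rfl fun i _ => hnorm i]
    exact (Equiv.sum_comp x.1 (fun i => ‖v i‖)).symm
  have hpos : ∑ i, ‖v i‖ ≠ 0 := by
    intro h0
    refine hv0 (funext fun i => ?_)
    have := (Finset.sum_eq_zero_iff_of_nonneg fun i _ => norm_nonneg (v i)).1 h0 i
      (Finset.mem_univ i)
    simpa using this
  exact mul_right_cancel₀ hpos (hsum.trans (one_mul _).symm)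

/-- `Δ_k(F, y) = (1 / k) ∑_{ω^k = y} F(ω)`, for `k ≥ 1`. -/
def rootAverage (F : Circle → ℂ) (k : ℕ) (y : Circle) : ℂ :=
  (1 / (k : ℂ)) * ∑ᶠ ω ∈ {ω : Circle | ω ^ k = y}, F ω

/-- The law of a product of `k` independent variables with law `ν`,
that is, the law of `Z_{k,m}`. -/
def cycleLaw (ν : Measure Circle) (k : ℕ) : Measure Circle :=
  (Measure.pi fun _ : Fin k => ν).map fun z => ∏ j, z j

/-- The characteristic function `s ↦ E[exp(i Re(s̄ X))]` of a complex random variable `X`.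
For real `s` and real valued `X` this is `E[exp(i s X)]`. -/
def charFunction {Ω : Type*} [MeasurableSpace Ω] (P : Measure Ω) (X : Ω → ℂ) (s : ℂ) : ℂ :=
  ∫ ω, Complex.exp (Complex.I * (((starRingEnd ℂ) s * X ω).re : ℂ)) ∂P

theorem charFunction_ofReal {Ω : Type*} [MeasurableSpace Ω] (P : Measure Ω) (X : Ω → ℝ) (s : ℝ) :
    charFunction P (fun ω => (X ω : ℂ)) s =
      ∫ ω, Complex.exp (Complex.I * (s : ℂ) * (X ω : ℂ)) ∂P := by
  simp [charFunction, mul_assoc]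

/-- `χ_k`, the characteristic function of `k Δ_k(F, Z_{k,1})`. -/
def cycleChar (F : Circle → ℂ) (ν : Measure Circle) (k : ℕ) (s : ℂ) : ℂ :=
  charFunction (cycleLaw ν k) (fun y => (k : ℂ) * rootAverage F k y) s

/-! ### Generating series -/

/-- The series `g_Θ(t) = ∑_{k ≥ 1} (θ_k / k) t^k`. The constant coefficient is `θ 0 / 0 = 0`. -/
def gTheta (θ : ℕ → ℝ) : PowerSeries ℂ :=
  PowerSeries.mk fun k => ((θ k / k : ℝ) : ℂ)

/-- The series `g_{tr(F)}(t) = ∑_{k ≥ 1} (θ_k / k) χ_k(s) t^k`. -/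
def gTrace (θ : ℕ → ℝ) (F : Circle → ℂ) (ν : Measure Circle) (s : ℂ) : PowerSeries ℂ :=
  PowerSeries.mk fun k => ((θ k / k : ℝ) : ℂ) * cycleChar F ν k s

/-- The class `eF(r, ϑ, γ)`: the power series `g` converges to a holomorphic function `G` on
the disc `|t| < r`, and `G(t) = ϑ log(1 / (1 - t / r)) + g₀(t)` there, for a power series `g₀`
whose coefficients are `O(r^{-N} N^{-1-γ})`. -/
def MemEF (r ϑ γ : ℝ) (g : PowerSeries ℂ) : Prop :=
  ∃ (G : ℂ → ℂ) (g₀ : PowerSeries ℂ),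
    DifferentiableOn ℂ G (Metric.ball 0 r) ∧
    (∀ t ∈ Metric.ball (0 : ℂ) r, HasSum (fun n => PowerSeries.coeff n g * t ^ n) (G t)) ∧
    (∀ t ∈ Metric.ball (0 : ℂ) r, HasSum (fun n => PowerSeries.coeff n g₀ * t ^ n)
      (G t - (ϑ : ℂ) * Complex.log (1 / (1 - t / (r : ℂ))))) ∧
    (fun N : ℕ => PowerSeries.coeff N g₀) =O[atTop]
      fun N : ℕ => (r ^ N)⁻¹ * (N : ℝ) ^ (-1 - γ)

/-! ### The limit variable -/

/-- `P_k` (`k ≥ 1`) are independent Poisson variables with parameters `θ_k r^k / k`, and `Z_{k,m}`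
are independent, independent of the `P_k`, and `Z_{k,m}` is distributed as a product of `k`
independent variables of law `ν`. Here `Z k m` stands for `Z_{k,m+1}`; nothing is required of
the laws for `k = 0`. -/
structure IsLimitData (θ : ℕ → ℝ) (r : ℝ) (ν : Measure Circle) {Ω : Type*} [MeasurableSpace Ω]
    (Pr : Measure Ω) (P : ℕ → Ω → ℕ) (Z : ℕ → ℕ → Ω → Circle) : Prop where
  law_P : ∀ k, 1 ≤ k → HasLaw (P k) (poissonMeasure (θ k * r ^ k / k).toNNReal) Pr
  law_Z : ∀ k m, 1 ≤ k → HasLaw (Z k m) (cycleLaw ν k) Pr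
  indep_P : iIndepFun (fun k : {k : ℕ // 1 ≤ k} => P k) Pr
  indep_Z : iIndepFun (fun a : {k : ℕ // 1 ≤ k} × ℕ => Z a.1 a.2) Pr
  indep_P_Z : IndepFun (fun ω (k : {k : ℕ // 1 ≤ k}) => P k ω)
    (fun ω (a : {k : ℕ // 1 ≤ k} × ℕ) => Z a.1 a.2 ω) Pr

/-- The `k`-th block `∑_{m=1}^{P_k} k Δ_k(F, Z_{k,m})` of the limit variable. -/
def limitBlock (F : Circle → ℂ) {Ω : Type*} (P : ℕ → Ω → ℕ) (Z : ℕ → ℕ → Ω → Circle)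
    (k : ℕ) (ω : Ω) : ℂ :=
  ∑ m ∈ Finset.range (P k ω), (k : ℂ) * rootAverage F k (Z k m ω)

/-- The limit variable `Y = ∑_{k ≥ 1} ∑_{m=1}^{P_k} k Δ_k(F, Z_{k,m})`
(the term with `k = 0` vanishes). -/
def limitVariable (F : Circle → ℂ) {Ω : Type*} (P : ℕ → Ω → ℕ) (Z : ℕ → ℕ → Ω → Circle)
    (ω : Ω) : ℂ :=
  ∑' k : ℕ, limitBlock F P Z k ω

end WreathTrace

end

open MeasureTheory ProbabilityTheory Filter Topology Asymptotics
open scoped BigOperators Nat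

noncomputable section

namespace WreathTrace

/-! ### The exponential of a power series -/

/-! Each `k`-cycle of `σ` contributes a factor `X ^ k - y` to the characteristic polynomial, where
`y` is the product of the `z_j` along the cycle, so `tr(F)` is a sum over cycles of `k Δ_k(F, y)`
(`wreathTrace_eq_sum`). Given `σ`, the products along different cycles are independent, hence the
conditional characteristic function is `∏ χ_k ^ C_k(σ)`. The exponential formula for the symmetric
group (`sum_perm_prod_cycleCount`) turns the average over `σ` into a ratio of coefficients, `[t^N]
exp(g_tr) / [t^N] exp(g_Θ)` (`charFunction_wreathTrace_eq`).

Since `θ_k r ^ k` is bounded and `|χ_k - 1| ≤ |s| k E|Δ_k| = O(k ^ (-δ))`, the difference `g_tr -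
g_Θ` has coefficients `O(r ^ (-k) k ^ (-1-δ))`. This gives the first claim. After rescaling `t` by
`r`, both exponentials have the form `(1 - t) ^ (-ϑ) exp(f(t))` with the coefficients of `f` being
`O(n ^ (-1-α))`, `α = min γ δ`.

The transfer to coefficients is elementary, with no contour integrals. Sequences of size `O(n ^
(-1-α))` form an algebra under convolution (`polyWeight_conv`), so `exp(f)` stays in this class and
its coefficients sum to `exp(f(1))` (`expSeries_polyWeight`). Convolving with the slowly changing
coefficients of `(1 - t) ^ (-ϑ)` multiplies these by `exp(f(1))`, up to a relative error `N ^ (-α)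
log N` (`conv_binomCoeff_isBigO`). In the ratio the binomial coefficients cancel and the exponential
of the summed difference remains.

For the limit variable, Wald's identity bounds the expected absolute size of the `k`-th block by a
summable sequence, whence almost sure absolute convergence. Conditioning on the Poisson variables
gives the compound Poisson characteristic function, which is the limit found above, and Lévy's
continuity theorem concludes. -/

/-- The formal exponential `exp(f)` of a power series with vanishing constant coefficient. -/
def expSeries (f : PowerSeries ℂ) : PowerSeries ℂ := (PowerSeries.exp ℂ).subst f

/-- The sum is finite in disguise, because `f ^ m` has order at least `m`. The `HasSum` form is what
the later interchange with a sum over `n` requires. -/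
theorem hasSum_coeff_expSeries {f : PowerSeries ℂ} (hf : PowerSeries.constantCoeff f = 0) (n : ℕ) :
    HasSum (fun m : ℕ => ((m ! : ℂ))⁻¹ * PowerSeries.coeff n (f ^ m))
      (PowerSeries.coeff n (expSeries f)) := by
  have hs := PowerSeries.HasSubst.of_constantCoeff_zero' hf
  have hfin := PowerSeries.coeff_subst_finite' hs (PowerSeries.exp ℂ) n
  have h : (fun m : ℕ => ((m ! : ℂ))⁻¹ * PowerSeries.coeff n (f ^ m)) =
      fun m => PowerSeries.coeff m (PowerSeries.exp ℂ) • PowerSeries.coeff n (f ^ m) := by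
    funext m
    simp [PowerSeries.coeff_exp]
  rw [h, expSeries, PowerSeries.coeff_subst' hs,
    ← tsum_eq_finsum (L := SummationFilter.unconditional ℕ) hfin]
  exact (summable_of_hasFiniteSupport hfin).hasSum

theorem constantCoeff_expSeries {f : PowerSeries ℂ} (hf : PowerSeries.constantCoeff f = 0) :
    PowerSeries.constantCoeff (expSeries f) = 1 := by
  have h := hasSum_coeff_expSeries hf 0
  simp only [PowerSeries.coeff_zero_eq_constantCoeff, map_pow, hf] at h
  refine h.unique ?_
  convert! hasSum_ite_eq 0 (1 : ℂ) using 2 with m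
  rcases m with _ | m <;> simp

theorem derivative_expSeries {f : PowerSeries ℂ} (hf : PowerSeries.constantCoeff f = 0) :
    PowerSeries.derivative ℂ (expSeries f) = expSeries f * PowerSeries.derivative ℂ f := by
  rw [expSeries, PowerSeries.derivative_subst (PowerSeries.HasSubst.of_constantCoeff_zero' hf),
    PowerSeries.derivative_exp]

/-- By the Leibniz rule the product has derivative zero. A general solution `e` of the differential
equation is allowed, so that the lemma also applies to `expSeries f` itself. -/
theorem mul_expSeries_neg {f e : PowerSeries ℂ} (hf : PowerSeries.constantCoeff f = 0)
    (he : PowerSeries.constantCoeff e = 1)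
    (hd : PowerSeries.derivative ℂ e = e * PowerSeries.derivative ℂ f) :
    e * expSeries (-f) = 1 := by
  have hf' : PowerSeries.constantCoeff (-f) = 0 := by simp [hf]
  refine PowerSeries.derivative.ext ?_ (by simp [he, constantCoeff_expSeries hf'])
  rw [Derivation.leibniz, hd, derivative_expSeries hf', PowerSeries.derivative_one, map_neg,
    smul_eq_mul, smul_eq_mul]
  ring

/-- Uniqueness for the linear equation `e' = e f'`. It identifies as exponentials the product of two
exponentials, the binomial series and the generating series of partitions. -/
theorem eq_expSeries {f e : PowerSeries ℂ} (hf : PowerSeries.constantCoeff f = 0)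
    (he : PowerSeries.constantCoeff e = 1)
    (hd : PowerSeries.derivative ℂ e = e * PowerSeries.derivative ℂ f) :
    e = expSeries f := by
  have h1 := mul_expSeries_neg hf he hd
  have h2 := mul_expSeries_neg hf (constantCoeff_expSeries hf) (derivative_expSeries hf)
  calc e = e * (expSeries f * expSeries (-f)) := by rw [h2, mul_one]
    _ = expSeries f * (e * expSeries (-f)) := by ring
    _ = expSeries f := by rw [h1, mul_one]

theorem expSeries_add {f g : PowerSeries ℂ} (hf : PowerSeries.constantCoeff f = 0)
    (hg : PowerSeries.constantCoeff g = 0) :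
    expSeries (f + g) = expSeries f * expSeries g := by
  refine (eq_expSeries (by simp [hf, hg]) ?_ ?_).symm
  · simp [constantCoeff_expSeries hf, constantCoeff_expSeries hg]
  · rw [Derivation.leibniz, derivative_expSeries hf, derivative_expSeries hg, map_add,
      smul_eq_mul, smul_eq_mul]
    ring

theorem expSeries_rescale {f : PowerSeries ℂ} (hf : PowerSeries.constantCoeff f = 0) (a : ℂ) :
    expSeries (PowerSeries.rescale a f) = PowerSeries.rescale a (expSeries f) := by
  ext n
  have hf' : PowerSeries.constantCoeff (PowerSeries.rescale a f) = 0 := by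
    rw [← PowerSeries.coeff_zero_eq_constantCoeff_apply, PowerSeries.coeff_rescale]
    simp [hf]
  have h := hasSum_coeff_expSeries hf' n
  simp only [← map_pow, PowerSeries.coeff_rescale] at h ⊢
  refine h.unique ?_
  convert! (hasSum_coeff_expSeries hf n).mul_left (a ^ n) using 2 with m
  ring

/-! ### Power series whose coefficients are dominated by a convolution weight -/

/-- `hconv` makes the space of sequences dominated by `u` a Banach algebra up to the constant `K`,
so each further factor `f` costs `K * C`. -/
theorem norm_coeff_pow_le {u : ℕ → ℝ} {K C : ℝ} (hu : ∀ n, 0 ≤ u n) (hu0 : u 0 = 1) (hC : 0 ≤ C)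
    (hK : 0 ≤ K)
    (hconv : ∀ n, ∑ p ∈ Finset.HasAntidiagonal.antidiagonal n, u p.1 * u p.2 ≤ K * u n)
    {f : PowerSeries ℂ} (hf : ∀ n, ‖PowerSeries.coeff n f‖ ≤ C * u n) (m n : ℕ) :
    ‖PowerSeries.coeff n (f ^ m)‖ ≤ (K * C) ^ m * u n := by
  induction m generalizing n with
  | zero =>
    rw [pow_zero, pow_zero, one_mul, PowerSeries.coeff_one]
    split_ifs with h
    · simp [h, hu0]
    · simpa using hu n
  | succ m ih =>
    rw [pow_succ, PowerSeries.coeff_mul]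
    calc _ ≤ ∑ p ∈ Finset.HasAntidiagonal.antidiagonal n, ‖PowerSeries.coeff p.1 (f ^ m) * PowerSeries.coeff p.2 f‖ :=
          norm_sum_le _ _
      _ ≤ ∑ p ∈ Finset.HasAntidiagonal.antidiagonal n, ((K * C) ^ m * C) * (u p.1 * u p.2) := by
          refine Finset.sum_le_sum fun p _ => ?_
          rw [norm_mul]
          calc _ ≤ ((K * C) ^ m * u p.1) * (C * u p.2) := by
                refine mul_le_mul (ih _) (hf _) (norm_nonneg _) ?_
                have := hu p.1
                positivity
            _ = _ := by ring
      _ ≤ ((K * C) ^ m * C) * (K * u n) := by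
          rw [← Finset.mul_sum]
          exact mul_le_mul_of_nonneg_left (hconv n) (by positivity)
      _ = _ := by ring

theorem norm_coeff_expSeries_le {u : ℕ → ℝ} {K C : ℝ} (hu : ∀ n, 0 ≤ u n) (hu0 : u 0 = 1)
    (hC : 0 ≤ C) (hK : 0 ≤ K)
    (hconv : ∀ n, ∑ p ∈ Finset.HasAntidiagonal.antidiagonal n, u p.1 * u p.2 ≤ K * u n)
    {f : PowerSeries ℂ} (h0 : PowerSeries.constantCoeff f = 0)
    (hf : ∀ n, ‖PowerSeries.coeff n f‖ ≤ C * u n) (n : ℕ) :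
    ‖PowerSeries.coeff n (expSeries f)‖ ≤ Real.exp (K * C) * u n := by
  have hexp : HasSum (fun m : ℕ => (m ! : ℝ)⁻¹ * ((K * C) ^ m * u n)) (Real.exp (K * C) * u n) := by
    have := (NormedSpace.expSeries_div_hasSum_exp (K * C)).mul_right (u n)
    rw [← Real.exp_eq_exp_ℝ] at this
    convert! this using 2
    ring
  refine (hasSum_coeff_expSeries h0 n).norm_le_of_bounded hexp fun m => ?_
  rw [norm_mul, norm_inv, Complex.norm_natCast]
  exact mul_le_mul_of_nonneg_left (norm_coeff_pow_le hu hu0 hC hK hconv hf m n) (by positivity)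

theorem hasSum_coeff_pow {f : PowerSeries ℂ} (hs : ∀ m, Summable fun n => ‖PowerSeries.coeff n (f ^ m)‖)
    (m : ℕ) :
    HasSum (fun n => PowerSeries.coeff n (f ^ m)) ((∑' n, PowerSeries.coeff n f) ^ m) := by
  induction m with
  | zero =>
    convert! hasSum_ite_eq 0 (1 : ℂ) using 2 with n
    simp [PowerSeries.coeff_one]
  | succ m ih =>
    have h1 : Summable fun n => ‖PowerSeries.coeff n f‖ := by simpa using hs 1
    rw [pow_succ (∑' n, PowerSeries.coeff n f), ← ih.tsum_eq,
      tsum_mul_tsum_eq_tsum_sum_antidiagonal_of_summable_norm (hs m) h1]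
    simp only [← PowerSeries.coeff_mul, ← pow_succ]
    exact (hs (m + 1)).of_norm.hasSum

/-- Evaluation at the boundary point `t = 1`: the double family indexed by the power `m` and the
degree `n` is absolutely summable, and it is summed in both orders. -/
theorem hasSum_expSeries {u : ℕ → ℝ} {K C : ℝ} (hu : ∀ n, 0 ≤ u n) (hu0 : u 0 = 1)
    (hus : Summable u) (hC : 0 ≤ C) (hK : 0 ≤ K)
    (hconv : ∀ n, ∑ p ∈ Finset.HasAntidiagonal.antidiagonal n, u p.1 * u p.2 ≤ K * u n)
    {f : PowerSeries ℂ} (h0 : PowerSeries.constantCoeff f = 0)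
    (hf : ∀ n, ‖PowerSeries.coeff n f‖ ≤ C * u n) :
    HasSum (fun n => PowerSeries.coeff n (expSeries f))
      (Complex.exp (∑' n, PowerSeries.coeff n f)) := by
  have hb := norm_coeff_pow_le hu hu0 hC hK hconv hf
  have hexp : Summable (fun m : ℕ => (m ! : ℝ)⁻¹ * (K * C) ^ m) := by
    convert! (NormedSpace.expSeries_div_hasSum_exp (K * C)).summable using 2
    ring
  have hprod : Summable fun p : ℕ × ℕ =>
      ((p.1 ! : ℂ))⁻¹ * PowerSeries.coeff p.2 (f ^ p.1) := by
    refine .of_norm_bounded (hexp.mul_of_nonneg hus (fun m => ?_) hu) fun p => ?_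
    · change (0 : ℝ) ≤ (m ! : ℝ)⁻¹ * (K * C) ^ m
      positivity
    · rw [norm_mul, norm_inv, Complex.norm_natCast, mul_assoc]
      exact mul_le_mul_of_nonneg_left (hb _ _) (by positivity)
  have hs : ∀ m, Summable fun n => ‖PowerSeries.coeff n (f ^ m)‖ := fun m =>
    .of_nonneg_of_le (fun _ => norm_nonneg _) (hb m) (hus.mul_left _)
  have hval : HasSum (fun p : ℕ × ℕ => ((p.1 ! : ℂ))⁻¹ * PowerSeries.coeff p.2 (f ^ p.1))
      (Complex.exp (∑' n, PowerSeries.coeff n f)) := by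
    have h0 (m : ℕ) : HasSum (fun n => ((m ! : ℂ))⁻¹ * PowerSeries.coeff n (f ^ m))
        ((m ! : ℂ)⁻¹ * (∑' n, PowerSeries.coeff n f) ^ m) := (hasSum_coeff_pow hs m).mul_left _
    have h1 := HasSum.prod_fiberwise hprod.hasSum h0
    have h2 := NormedSpace.expSeries_div_hasSum_exp (∑' n, PowerSeries.coeff n f)
    rw [← Complex.exp_eq_exp_ℂ] at h2
    have h3 : (fun m : ℕ => ((m ! : ℂ))⁻¹ * (∑' n, PowerSeries.coeff n f) ^ m) =
        fun m => (∑' n, PowerSeries.coeff n f) ^ m / (m ! : ℂ) := by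
      funext m
      rw [div_eq_inv_mul]
    rw [h3] at h1
    rw [← h1.unique h2]
    exact hprod.hasSum
  have hswap : HasSum (fun p : ℕ × ℕ => ((p.2 ! : ℂ))⁻¹ * PowerSeries.coeff p.1 (f ^ p.2))
      (Complex.exp (∑' n, PowerSeries.coeff n f)) := (Equiv.prodComm ℕ ℕ).hasSum_iff.2 hval
  exact HasSum.prod_fiberwise hswap fun n => hasSum_coeff_expSeries h0 n

/-- The weight `(n + 1) ^ (-1 - α)`. -/
def polyWeight (α : ℝ) (n : ℕ) : ℝ := ((n : ℝ) + 1) ^ (-1 - α)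

theorem polyWeight_pos (α : ℝ) (n : ℕ) : 0 < polyWeight α n :=
  Real.rpow_pos_of_pos (by positivity) _

theorem polyWeight_zero (α : ℝ) : polyWeight α 0 = 1 := by simp [polyWeight]

theorem summable_polyWeight {α : ℝ} (hα : 0 < α) : Summable (polyWeight α) := by
  have := (summable_nat_add_iff 1).2 (Real.summable_nat_rpow (p := -1 - α) |>.2 (by linarith))
  simpa [polyWeight] using! this

theorem polyWeight_le_of_le_two_mul {α : ℝ} (hα : 0 < α) {i n : ℕ} (h : n + 1 ≤ 2 * (i + 1)) :
    polyWeight α i ≤ 2 ^ (1 + α) * polyWeight α n := by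
  have h' : ((n : ℝ) + 1) / 2 ≤ (i : ℝ) + 1 := by
    have : ((n : ℝ) + 1) ≤ 2 * ((i : ℝ) + 1) := by exact_mod_cast h
    linarith
  calc polyWeight α i ≤ (((n : ℝ) + 1) / 2) ^ (-1 - α) :=
        Real.rpow_le_rpow_of_nonpos (by positivity) h' (by linarith)
    _ = _ := by
        rw [Real.div_rpow (by positivity) (by norm_num), polyWeight,
          show (-1 - α) = -(1 + α) by ring, Real.rpow_neg (x := 2) (by norm_num)]
        field_simp

/-- In each pair with sum `n` the larger index is at least `n / 2`, so its weight is at most `2 ^ (1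
+ α)` times that of `n`; the weights of the other index are summable. -/
theorem polyWeight_conv {α : ℝ} (hα : 0 < α) (n : ℕ) :
    ∑ p ∈ Finset.HasAntidiagonal.antidiagonal n, polyWeight α p.1 * polyWeight α p.2 ≤
      (2 * 2 ^ (1 + α) * ∑' k, polyWeight α k) * polyWeight α n := by
  have hsum : ∑ i ∈ Finset.range (n + 1), polyWeight α i ≤ ∑' k, polyWeight α k :=
    (summable_polyWeight hα).sum_le_tsum _ fun i _ => (polyWeight_pos α i).le
  have h1 : ∑ p ∈ Finset.HasAntidiagonal.antidiagonal n, polyWeight α p.1 =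
      ∑ i ∈ Finset.range (n + 1), polyWeight α i :=
    Finset.Nat.sum_antidiagonal_eq_sum_range_succ (fun i _ => polyWeight α i) n
  have h2 : ∑ p ∈ Finset.HasAntidiagonal.antidiagonal n, polyWeight α p.2 =
      ∑ i ∈ Finset.range (n + 1), polyWeight α i := by
    rw [← h1]
    exact Finset.Nat.sum_antidiagonal_swap (f := fun p => polyWeight α p.1)
  have hW := polyWeight_pos α
  calc _ ≤ ∑ p ∈ Finset.HasAntidiagonal.antidiagonal n,
        (2 ^ (1 + α) * polyWeight α n) * (polyWeight α p.1 + polyWeight α p.2) := by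
        refine Finset.sum_le_sum fun p hp => ?_
        have hp' := Finset.HasAntidiagonal.mem_antidiagonal.1 hp
        have a := hW p.1
        have b := hW p.2
        have c := hW n
        have d : (0 : ℝ) < 2 ^ (1 + α) := by positivity
        rcases le_total p.1 p.2 with h | h
        · have := mul_le_mul_of_nonneg_left
            (polyWeight_le_of_le_two_mul hα (i := p.2) (n := n) (by omega)) a.le
          have e : 0 < 2 ^ (1 + α) * polyWeight α n * polyWeight α p.2 := by positivity
          linarith
        · have := mul_le_mul_of_nonneg_right
            (polyWeight_le_of_le_two_mul hα (i := p.1) (n := n) (by omega)) b.le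
          have e : 0 < 2 ^ (1 + α) * polyWeight α n * polyWeight α p.1 := by positivity
          linarith
    _ = (2 ^ (1 + α) * polyWeight α n) * (2 * ∑ i ∈ Finset.range (n + 1), polyWeight α i) := by
        rw [← Finset.mul_sum, Finset.sum_add_distrib, h1, h2, two_mul]
    _ ≤ (2 ^ (1 + α) * polyWeight α n) * (2 * ∑' k, polyWeight α k) := by
        have c := hW n
        gcongr
    _ = _ := by ring

/-- The exponential preserves the class of series with coefficients `O(n ^ (-1 - α))`, and may be
evaluated at the boundary point `1`. -/
theorem expSeries_polyWeight {α C : ℝ} (hα : 0 < α) {f : PowerSeries ℂ}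
    (h0 : PowerSeries.constantCoeff f = 0)
    (hf : ∀ n, ‖PowerSeries.coeff n f‖ ≤ C * polyWeight α n) :
    (∃ B, ∀ n, ‖PowerSeries.coeff n (expSeries f)‖ ≤ B * polyWeight α n) ∧
    HasSum (fun n => PowerSeries.coeff n (expSeries f))
      (Complex.exp (∑' n, PowerSeries.coeff n f)) := by
  have hW n := (polyWeight_pos α n).le
  have hC : 0 ≤ C := by
    have := (norm_nonneg _).trans (hf 0)
    rwa [polyWeight_zero, mul_one] at this
  have hK : 0 ≤ 2 * 2 ^ (1 + α) * ∑' k, polyWeight α k :=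
    mul_nonneg (by positivity) (tsum_nonneg hW)
  exact ⟨⟨_, norm_coeff_expSeries_le hW (polyWeight_zero α) hC hK (polyWeight_conv hα) h0 hf⟩,
    hasSum_expSeries hW (polyWeight_zero α) (summable_polyWeight hα) hC hK (polyWeight_conv hα)
      h0 hf⟩

/-! ### The coefficients of `(1 - t) ^ (-ϑ)` -/

/-- The coefficient of `t ^ n` in `(1 - t) ^ (-ϑ)`. -/
def binomCoeff (ϑ : ℝ) (n : ℕ) : ℝ := ∏ i ∈ Finset.range n, ((i : ℝ) + ϑ) / ((i : ℝ) + 1)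

theorem binomCoeff_zero (ϑ : ℝ) : binomCoeff ϑ 0 = 1 := by simp [binomCoeff]

theorem binomCoeff_succ (ϑ : ℝ) (n : ℕ) :
    binomCoeff ϑ (n + 1) = binomCoeff ϑ n * (((n : ℝ) + ϑ) / ((n : ℝ) + 1)) := by
  rw [binomCoeff, binomCoeff, Finset.prod_range_succ]

theorem binomCoeff_pos {ϑ : ℝ} (hϑ : 0 < ϑ) (n : ℕ) : 0 < binomCoeff ϑ n :=
  Finset.prod_pos fun i _ => by positivity

/-- Partial sums of the coefficients of `(1 - t) ^ (-ϑ)` are the coefficients of `(1 - t) ^ (-ϑ -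
1)`. -/
theorem sum_binomCoeff (ϑ : ℝ) (n : ℕ) :
    ϑ * ∑ i ∈ Finset.range (n + 1), binomCoeff ϑ i = ((n : ℝ) + ϑ) * binomCoeff ϑ n := by
  induction n with
  | zero => simp [binomCoeff_zero]
  | succ n ih =>
    rw [Finset.sum_range_succ, mul_add, ih, binomCoeff_succ]
    push_cast
    field_simp

/-- Coefficientwise, the equation `e' = e ϑ / (1 - t)` is the partial sum identity `sum_binomCoeff`.
The constant coefficient `ϑ / 0` is zero by convention. -/
theorem mk_binomCoeff_eq_expSeries (ϑ : ℝ) :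
    PowerSeries.mk (fun n => (binomCoeff ϑ n : ℂ)) =
      expSeries (PowerSeries.mk fun n : ℕ => (ϑ / n : ℂ)) := by
  refine eq_expSeries ?_ ?_ ?_
  · simp [← PowerSeries.coeff_zero_eq_constantCoeff_apply]
  · simp [← PowerSeries.coeff_zero_eq_constantCoeff_apply, binomCoeff_zero]
  · ext n
    rw [PowerSeries.coeff_mul]
    simp only [PowerSeries.coeff_derivative, PowerSeries.coeff_mk]
    have h (p : ℕ × ℕ) : (binomCoeff ϑ p.1 : ℂ) * ((ϑ : ℂ) / ((p.2 + 1 : ℕ) : ℂ) * ((p.2 : ℂ) + 1))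
        = ϑ * (binomCoeff ϑ p.1 : ℂ) := by
      have : (p.2 : ℂ) + 1 ≠ 0 := Nat.cast_add_one_ne_zero _
      push_cast
      field_simp
    simp only [h]
    rw [Finset.Nat.sum_antidiagonal_eq_sum_range_succ (fun i _ => (ϑ : ℂ) * (binomCoeff ϑ i : ℂ)) n,
      ← Finset.mul_sum]
    have := congrArg (fun x : ℝ => (x : ℂ)) (sum_binomCoeff ϑ n)
    push_cast at this
    rw [this, binomCoeff_succ]
    have h1 : (n : ℂ) + 1 ≠ 0 := Nat.cast_add_one_ne_zero _
    push_cast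
    field_simp

/-- Each backward step multiplies by `(k + 1) / (k + ϑ)`, at most `1 + |1 - ϑ| / m` since `k + ϑ ≥
m`. This replaces Gamma function asymptotics and treats `ϑ < 1` and `ϑ ≥ 1` alike. -/
theorem binomCoeff_le {ϑ : ℝ} (hϑ : 0 < ϑ) {m : ℕ} (hm : 0 < m) (d : ℕ) :
    binomCoeff ϑ m ≤ Real.exp (|1 - ϑ| * d / m) * binomCoeff ϑ (m + d) := by
  have hm' : (0 : ℝ) < m := by exact_mod_cast hm
  induction d with
  | zero => simp
  | succ d ih =>
    refine ih.trans ?_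
    have hc := binomCoeff_pos hϑ (m + d)
    have h1 : 1 ≤ Real.exp (|1 - ϑ| / m) * ((((m + d : ℕ) : ℝ) + ϑ) / (((m + d : ℕ) : ℝ) + 1)) := by
      have hk : (m : ℝ) ≤ ((m + d : ℕ) : ℝ) + ϑ := by
        push_cast
        have : (0 : ℝ) ≤ d := Nat.cast_nonneg d
        linarith
      have h2 : 1 + |1 - ϑ| / m ≤ Real.exp (|1 - ϑ| / m) := by
        rw [add_comm]
        exact Real.add_one_le_exp _
      have h3 : (((m + d : ℕ) : ℝ) + 1) ≤ (1 + |1 - ϑ| / m) * (((m + d : ℕ) : ℝ) + ϑ) := by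
        have h4 : |1 - ϑ| / m * m ≤ |1 - ϑ| / m * (((m + d : ℕ) : ℝ) + ϑ) := by gcongr
        rw [div_mul_cancel₀ _ hm'.ne'] at h4
        have := le_abs_self (1 - ϑ)
        linarith
      rw [← mul_div_assoc, one_le_div (by positivity)]
      exact h3.trans (by gcongr)
    rw [← add_assoc, binomCoeff_succ]
    have h5 : |1 - ϑ| * ((d + 1 : ℕ) : ℝ) / m = |1 - ϑ| * d / m + |1 - ϑ| / m := by
      push_cast
      ring
    rw [h5, Real.exp_add]
    calc _ = Real.exp (|1 - ϑ| * d / m) * binomCoeff ϑ (m + d) * 1 := by ring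
      _ ≤ Real.exp (|1 - ϑ| * d / m) * binomCoeff ϑ (m + d) *
          (Real.exp (|1 - ϑ| / m) * ((((m + d : ℕ) : ℝ) + ϑ) / (((m + d : ℕ) : ℝ) + 1))) := by
          gcongr
      _ = _ := by ring

theorem binomCoeff_le_of_le_two_mul {ϑ : ℝ} (hϑ : 0 < ϑ) {m n : ℕ} (hm : 0 < m) (hmn : m ≤ n)
    (hn : n ≤ 2 * m) : binomCoeff ϑ m ≤ Real.exp |1 - ϑ| * binomCoeff ϑ n := by
  obtain ⟨d, rfl⟩ := Nat.exists_eq_add_of_le hmn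
  refine (binomCoeff_le hϑ hm d).trans ?_
  have hc := (binomCoeff_pos hϑ (m + d)).le
  gcongr
  have hm' : (0 : ℝ) < m := by exact_mod_cast hm
  have hd : (d : ℝ) ≤ m := by exact_mod_cast (by omega : d ≤ m)
  rw [div_le_iff₀ hm']
  gcongr

/-- Telescoping over `j` steps: a consecutive difference is `binomCoeff ϑ k * (1 - ϑ) / (k + 1)`,
and for `k ≥ n / 2` the coefficient is comparable with that of index `n`. -/
theorem abs_binomCoeff_sub_le {ϑ : ℝ} (hϑ : 0 < ϑ) {j n : ℕ} (hn : 0 < n) (hj : 2 * j ≤ n) :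
    |binomCoeff ϑ (n - j) - binomCoeff ϑ n| ≤
      2 * |1 - ϑ| * Real.exp |1 - ϑ| * j / n * binomCoeff ϑ n := by
  have hn' : (0 : ℝ) < n := by exact_mod_cast hn
  have hd : ∀ {k}, n - j ≤ k → k < n → dist (binomCoeff ϑ k) (binomCoeff ϑ (k + 1)) ≤
      2 * |1 - ϑ| * Real.exp |1 - ϑ| / n * binomCoeff ϑ n := by
    intro k hk hkn
    have hc := binomCoeff_pos hϑ k
    have h1 := binomCoeff_le_of_le_two_mul hϑ (m := k) (n := n) (by omega) hkn.le (by omega)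
    have h2 : binomCoeff ϑ k - binomCoeff ϑ (k + 1) = binomCoeff ϑ k * ((1 - ϑ) / ((k : ℝ) + 1)) := by
      rw [binomCoeff_succ]
      field_simp
      ring
    have h3 : (n : ℝ) ≤ 2 * ((k : ℝ) + 1) := by exact_mod_cast (by omega : n ≤ 2 * (k + 1))
    have h4 : ((k : ℝ) + 1)⁻¹ ≤ 2 / n := by
      rw [inv_le_comm₀ (by positivity) (by positivity), inv_div]
      linarith
    rw [Real.dist_eq, h2, abs_mul, abs_div, abs_of_pos hc,
      abs_of_pos (by positivity : (0 : ℝ) < (k : ℝ) + 1), div_eq_mul_inv]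
    calc _ ≤ (Real.exp |1 - ϑ| * binomCoeff ϑ n) * (|1 - ϑ| * (2 / n)) := by
          have := binomCoeff_pos hϑ n
          gcongr
      _ = _ := by ring
  have h := dist_le_Ico_sum_of_dist_le (Nat.sub_le n j) hd
  rw [Real.dist_eq, Finset.sum_const, Nat.card_Ico, nsmul_eq_mul, Nat.sub_sub_self (by omega)] at h
  refine h.trans_eq ?_
  ring

/-! ### Convolution with the coefficients of `(1 - t) ^ (-ϑ)` -/

/-- A discrete form of comparison with `∫ x ^ (-1 - α)`, making the tail sums telescope. -/
theorem mul_polyWeight_succ_le {α : ℝ} (hα : 0 < α) {j : ℕ} (hj : 0 < j) :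
    α * polyWeight α j ≤ (j : ℝ) ^ (-α) - ((j + 1 : ℕ) : ℝ) ^ (-α) := by
  have hj' : (0 : ℝ) < j := by exact_mod_cast hj
  have hlog : 1 / ((j : ℝ) + 1) ≤ Real.log (((j : ℝ) + 1) / j) := by
    refine le_trans (le_of_eq ?_) (Real.one_sub_inv_le_log_of_pos (by positivity))
    field_simp
    ring
  have hpow : 1 + α * (1 / ((j : ℝ) + 1)) ≤ (((j : ℝ) + 1) / j) ^ α := by
    rw [Real.rpow_def_of_pos (by positivity)]
    refine le_trans ?_ (Real.add_one_le_exp _)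
    nlinarith
  have h1 : (j : ℝ) ^ (-α) = (((j : ℝ) + 1) / j) ^ α * ((j : ℝ) + 1) ^ (-α) := by
    rw [Real.div_rpow (by positivity) hj'.le, Real.rpow_neg hj'.le, Real.rpow_neg (by positivity)]
    field_simp
  have h2 : polyWeight α j = 1 / ((j : ℝ) + 1) * ((j : ℝ) + 1) ^ (-α) := by
    rw [polyWeight, sub_eq_add_neg, Real.rpow_add (by positivity), Real.rpow_neg_one, one_div]
  have h3 : (0 : ℝ) < ((j : ℝ) + 1) ^ (-α) := by positivity
  push_cast
  rw [h1, h2]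
  nlinarith

theorem tsum_polyWeight_add_le {α : ℝ} (hα : 0 < α) {N : ℕ} (hN : 0 < N) :
    ∑' j, polyWeight α (j + N) ≤ (N : ℝ) ^ (-α) / α := by
  refine Real.tsum_le_of_sum_range_le (fun j => (polyWeight_pos α _).le) fun n => ?_
  rw [le_div_iff₀ hα, Finset.sum_mul]
  calc _ ≤ ∑ j ∈ Finset.range n, (((j + N : ℕ) : ℝ) ^ (-α) - ((j + 1 + N : ℕ) : ℝ) ^ (-α)) := by
        refine Finset.sum_le_sum fun j _ => ?_
        rw [mul_comm, show j + 1 + N = j + N + 1 by ring]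
        exact mul_polyWeight_succ_le hα (by omega)
    _ = ((0 + N : ℕ) : ℝ) ^ (-α) - ((n + N : ℕ) : ℝ) ^ (-α) :=
        Finset.sum_range_sub' (fun j => ((j + N : ℕ) : ℝ) ^ (-α)) n
    _ ≤ _ := by
        rw [zero_add]
        have : (0 : ℝ) ≤ ((n + N : ℕ) : ℝ) ^ (-α) := by positivity
        linarith

theorem mul_polyWeight_self (α : ℝ) (n : ℕ) :
    ((n : ℝ) + 1) * polyWeight α n = ((n : ℝ) + 1) ^ (-α) := by
  rw [polyWeight, sub_eq_add_neg, Real.rpow_add (by positivity), Real.rpow_neg_one]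
  field_simp

/-- Origin of the logarithm in the error term: each summand is at most `(N + 1) ^ (1 - α) / (j +
1)`, which leaves a harmonic sum. -/
theorem sum_mul_polyWeight_le {α : ℝ} (hα' : α ≤ 1) (N : ℕ) :
    ∑ j ∈ Finset.range (N + 1), (j : ℝ) * polyWeight α j ≤
      ((N : ℝ) + 1) ^ (1 - α) * (1 + Real.log ((N : ℝ) + 1)) := by
  have hh := harmonic_le_one_add_log (N + 1)
  rw [harmonic] at hh
  push_cast at hh
  calc _ ≤ ∑ j ∈ Finset.range (N + 1), ((N : ℝ) + 1) ^ (1 - α) * ((j : ℝ) + 1)⁻¹ := by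
        refine Finset.sum_le_sum fun j hj => ?_
        have hjN : (j : ℝ) + 1 ≤ (N : ℝ) + 1 := by
          exact_mod_cast (Finset.mem_range.1 hj)
        have h1 : ((j : ℝ) + 1) ^ (-α) = ((j : ℝ) + 1) ^ (1 - α) * ((j : ℝ) + 1)⁻¹ := by
          rw [← Real.rpow_neg_one, ← Real.rpow_add (by positivity)]
          congr 1
          ring
        calc (j : ℝ) * polyWeight α j ≤ ((j : ℝ) + 1) * polyWeight α j := by
              have := polyWeight_pos α j
              gcongr
              linarith
          _ = ((j : ℝ) + 1) ^ (1 - α) * ((j : ℝ) + 1)⁻¹ := by rw [mul_polyWeight_self, h1]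
          _ ≤ _ := by
              gcongr
    _ ≤ _ := by
        rw [← Finset.mul_sum]
        gcongr

/-- For `2 * j ≤ N` the difference of binomial coefficients is small; otherwise the weight of `j` is
comparable with that of `N`. Adding the two bounds spares a case split inside the sum. -/
theorem norm_conv_term_le {ϑ α B : ℝ} (hϑ : 0 < ϑ) (hα : 0 < α) (hB : 0 ≤ B) {b : ℕ → ℂ}
    (hb : ∀ n, ‖b n‖ ≤ B * polyWeight α n) {j N : ℕ} (hN : 0 < N) :
    ‖b j * ((binomCoeff ϑ (N - j) - binomCoeff ϑ N : ℝ) : ℂ)‖ ≤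
      B * (2 * |1 - ϑ| * Real.exp |1 - ϑ|) / N * binomCoeff ϑ N * (j * polyWeight α j) +
      B * (2 ^ (1 + α) * polyWeight α N) * (binomCoeff ϑ (N - j) + binomCoeff ϑ N) := by
  have hc := binomCoeff_pos hϑ N
  have hc' := binomCoeff_pos hϑ (N - j)
  have hw := polyWeight_pos α j
  have hw' := polyWeight_pos α N
  rw [norm_mul, Complex.norm_real, Real.norm_eq_abs]
  by_cases h : 2 * j ≤ N
  · refine le_add_of_le_of_nonneg ?_ (by positivity)
    calc _ ≤ (B * polyWeight α j) *
        (2 * |1 - ϑ| * Real.exp |1 - ϑ| * j / N * binomCoeff ϑ N) :=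
          mul_le_mul (hb j) (abs_binomCoeff_sub_le hϑ hN h) (abs_nonneg _) (by positivity)
      _ = _ := by ring
  · refine le_add_of_nonneg_of_le (by positivity) ?_
    refine mul_le_mul ((hb j).trans ?_) ?_ (abs_nonneg _) (by positivity)
    · gcongr
      exact polyWeight_le_of_le_two_mul hα (by omega)
    · rw [abs_le]
      constructor <;> linarith

theorem norm_conv_sub_le {ϑ α B : ℝ} (hϑ : 0 < ϑ) (hα : 0 < α) (hα' : α ≤ 1) {b : ℕ → ℂ}
    (hb : ∀ n, ‖b n‖ ≤ B * polyWeight α n) {N : ℕ} (hN : 0 < N) :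
    ‖(∑ p ∈ Finset.HasAntidiagonal.antidiagonal N, b p.1 * (binomCoeff ϑ p.2 : ℂ)) /
        (binomCoeff ϑ N : ℂ) - ∑' n, b n‖ ≤
      B * (2 * |1 - ϑ| * Real.exp |1 - ϑ|) / N *
          (((N : ℝ) + 1) ^ (1 - α) * (1 + Real.log ((N : ℝ) + 1))) +
        B * 2 ^ (1 + α) * (2 + 1 / ϑ) * ((N : ℝ) + 1) ^ (-α) +
        B * (((N + 1 : ℕ) : ℝ) ^ (-α) / α) := by
  have hB : 0 ≤ B := by
    have := (norm_nonneg _).trans (hb 0)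
    rwa [polyWeight_zero, mul_one] at this
  have hc := binomCoeff_pos hϑ N
  have hc0 : (binomCoeff ϑ N : ℂ) ≠ 0 := by exact_mod_cast hc.ne'
  have hw := polyWeight_pos α N
  have hbn : Summable fun n => ‖b n‖ :=
    .of_nonneg_of_le (fun _ => norm_nonneg _) hb ((summable_polyWeight hα).mul_left B)
  have hbs : Summable b := hbn.of_norm
  rw [Finset.Nat.sum_antidiagonal_eq_sum_range_succ
    (fun i j => b i * (binomCoeff ϑ j : ℂ)) N]
  -- Freezing the binomial factor at `N` produces the partial sum of `b`. What remains is the effect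
  -- of the differences and the tail of the series.
  have hsplit : (∑ j ∈ Finset.range (N + 1), b j * (binomCoeff ϑ (N - j) : ℂ)) /
        (binomCoeff ϑ N : ℂ) - ∑' n, b n =
      (∑ j ∈ Finset.range (N + 1), b j * ((binomCoeff ϑ (N - j) - binomCoeff ϑ N : ℝ) : ℂ)) /
        (binomCoeff ϑ N : ℂ) - ∑' n, b (n + (N + 1)) := by
    rw [← hbs.sum_add_tsum_nat_add (N + 1)]
    push_cast
    simp only [mul_sub, Finset.sum_sub_distrib]
    rw [sub_div, ← Finset.sum_mul, mul_div_cancel_right₀ _ hc0]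
    ring
  rw [hsplit]
  refine (norm_sub_le _ _).trans (add_le_add ?_ ?_)
  · rw [norm_div, Complex.norm_real, Real.norm_eq_abs, abs_of_pos hc, div_le_iff₀ hc]
    refine (norm_sum_le _ _).trans ((Finset.sum_le_sum fun j _ =>
      norm_conv_term_le hϑ hα hB hb hN).trans ?_)
    rw [Finset.sum_add_distrib, ← Finset.mul_sum, ← Finset.mul_sum, Finset.sum_add_distrib,
      Finset.sum_const, Finset.card_range, nsmul_eq_mul, add_mul]
    refine add_le_add ?_ ?_
    · have := sum_mul_polyWeight_le hα' N
      calc _ ≤ B * (2 * |1 - ϑ| * Real.exp |1 - ϑ|) / N * binomCoeff ϑ N *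
            (((N : ℝ) + 1) ^ (1 - α) * (1 + Real.log ((N : ℝ) + 1))) := by gcongr
        _ = _ := by ring
    -- The far indices need the full sum of the binomial coefficients, which is about `N / ϑ` times
    -- the last one.
    · have h1 : ∑ j ∈ Finset.range (N + 1), binomCoeff ϑ (N - j) =
          ((N : ℝ) + ϑ) * binomCoeff ϑ N / ϑ := by
        rw [eq_div_iff hϑ.ne', mul_comm, ← sum_binomCoeff,
          ← Finset.sum_range_reflect (fun i => binomCoeff ϑ i)]
        simp
      rw [h1, ← mul_polyWeight_self]
      push_cast
      have h2 : ((N : ℝ) + ϑ) / ϑ ≤ (1 + 1 / ϑ) * ((N : ℝ) + 1) := by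
        rw [div_le_iff₀ hϑ]
        have : (1 + 1 / ϑ) * ((N : ℝ) + 1) * ϑ = (ϑ + 1) * ((N : ℝ) + 1) := by field_simp
        rw [this]
        have : (0 : ℝ) ≤ N := Nat.cast_nonneg N
        nlinarith
      calc _ = B * (2 ^ (1 + α) * polyWeight α N) * binomCoeff ϑ N *
            (((N : ℝ) + ϑ) / ϑ + ((N : ℝ) + 1)) := by ring
        _ ≤ B * (2 ^ (1 + α) * polyWeight α N) * binomCoeff ϑ N *
            ((1 + 1 / ϑ) * ((N : ℝ) + 1) + ((N : ℝ) + 1)) := by gcongr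
        _ = _ := by ring
  · have h1 : Summable fun n => ‖b (n + (N + 1))‖ := (summable_nat_add_iff (N + 1)).2 hbn
    refine (norm_tsum_le_tsum_norm h1).trans ?_
    calc _ ≤ ∑' n, B * polyWeight α (n + (N + 1)) :=
          h1.tsum_le_tsum (fun n => hb _)
            (((summable_nat_add_iff (N + 1)).2 (summable_polyWeight hα)).mul_left B)
      _ ≤ _ := by
          rw [tsum_mul_left]
          gcongr
          exact tsum_polyWeight_add_le hα (Nat.succ_pos N)

/-- If `b n = O(n ^ (-1 - α))`, the coefficient of `t ^ N` in `(∑ b n t ^ n) (1 - t) ^ (-ϑ)` is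
asymptotic to `∑ b n` times that of `(1 - t) ^ (-ϑ)`. -/
theorem conv_binomCoeff_isBigO {ϑ α B : ℝ} (hϑ : 0 < ϑ) (hα : 0 < α) (hα' : α ≤ 1) {b : ℕ → ℂ}
    (hb : ∀ n, ‖b n‖ ≤ B * polyWeight α n) :
    (fun N : ℕ => (∑ p ∈ Finset.HasAntidiagonal.antidiagonal N, b p.1 * (binomCoeff ϑ p.2 : ℂ)) /
        (binomCoeff ϑ N : ℂ) - ∑' n, b n) =O[atTop]
      fun N : ℕ => (N : ℝ) ^ (-α) * Real.log N := by
  have hB : 0 ≤ B := by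
    have := (norm_nonneg _).trans (hb 0)
    rwa [polyWeight_zero, mul_one] at this
  refine .of_bound (B * (2 * |1 - ϑ| * Real.exp |1 - ϑ|) * 6 + B * 2 ^ (1 + α) * (2 + 1 / ϑ) + B / α)
    ?_
  -- From `N = 3` on, `log N ≥ 1`, which absorbs the additive constants. The factor `6` is `2 * 3`,
  -- from `(N + 1) ^ (1 - α) ≤ 2 N ^ (1 - α)` and `1 + log (N + 1) ≤ 3 log N`.
  filter_upwards [eventually_ge_atTop 3] with N hN
  have hN' : (3 : ℝ) ≤ N := by exact_mod_cast hN
  have hN0 : (0 : ℝ) < N := by linarith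
  have hlog : 1 ≤ Real.log N := by
    rw [Real.le_log_iff_exp_le hN0]
    exact Real.exp_one_lt_three.le.trans hN'
  have hX : (0 : ℝ) < (N : ℝ) ^ (-α) := by positivity
  have hX1 : ((N : ℝ) + 1) ^ (-α) ≤ (N : ℝ) ^ (-α) * Real.log N := by
    refine (Real.rpow_le_rpow_of_nonpos hN0 (by linarith) (by linarith)).trans ?_
    nlinarith
  have hX2 : ((N : ℝ) + 1) ^ (1 - α) * (1 + Real.log ((N : ℝ) + 1)) ≤
      N * (6 * ((N : ℝ) ^ (-α) * Real.log N)) := by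
    have h1 : ((N : ℝ) + 1) ^ (1 - α) ≤ 2 * (N * (N : ℝ) ^ (-α)) := by
      calc ((N : ℝ) + 1) ^ (1 - α) ≤ (2 * (N : ℝ)) ^ (1 - α) :=
            Real.rpow_le_rpow (by positivity) (by linarith) (by linarith)
        _ = 2 ^ (1 - α) * (N : ℝ) ^ (1 - α) := Real.mul_rpow (by norm_num) hN0.le
        _ ≤ 2 ^ (1 : ℝ) * (N : ℝ) ^ (1 - α) := by
            gcongr
            · norm_num
            · linarith
        _ = _ := by
            rw [Real.rpow_one, sub_eq_add_neg, Real.rpow_add hN0, Real.rpow_one]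
    have h2 : Real.log ((N : ℝ) + 1) ≤ Real.log 2 + Real.log N := by
      rw [← Real.log_mul (by norm_num) hN0.ne']
      exact Real.log_le_log (by positivity) (by linarith)
    have h3 : 1 + Real.log ((N : ℝ) + 1) ≤ 3 * Real.log N := by
      have := Real.log_two_lt_d9
      linarith
    calc _ ≤ 2 * (N * (N : ℝ) ^ (-α)) * (3 * Real.log N) :=
          mul_le_mul h1 h3 (by
            have : 0 ≤ Real.log ((N : ℝ) + 1) := Real.log_nonneg (by linarith)
            positivity) (by positivity)
      _ = _ := by ring
  have hlog0 : 0 ≤ Real.log N := by linarith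
  refine (norm_conv_sub_le hϑ hα hα' hb (by omega : 0 < N)).trans ?_
  push_cast
  have hY : 0 ≤ (N : ℝ) ^ (-α) * Real.log N := by positivity
  rw [Real.norm_eq_abs, abs_of_nonneg hY, add_mul, add_mul]
  refine add_le_add (add_le_add ?_ ?_) ?_
  · calc _ ≤ B * (2 * |1 - ϑ| * Real.exp |1 - ϑ|) / N *
          (N * (6 * ((N : ℝ) ^ (-α) * Real.log N))) :=
          mul_le_mul_of_nonneg_left hX2 (by positivity)
      _ = _ := by field_simp
  · gcongr
  · calc _ ≤ B * (((N : ℝ) ^ (-α) * Real.log N) / α) := by gcongr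
      _ = _ := by ring

/-! ### Sums over permutations as coefficients of an exponential -/

/-- The multisets of positive integers with sum `n`. -/
def partitionFinset (n : ℕ) : Finset (Multiset ℕ) :=
  Finset.univ.image fun p : n.Partition => p.parts

theorem mem_partitionFinset {n : ℕ} {s : Multiset ℕ} :
    s ∈ partitionFinset n ↔ (∀ i ∈ s, 0 < i) ∧ s.sum = n := by
  simp only [partitionFinset, Finset.mem_image, Finset.mem_univ, true_and]
  constructor
  · rintro ⟨p, rfl⟩
    exact ⟨fun i hi => p.parts_pos hi, p.parts_sum⟩
  · rintro ⟨h1, h2⟩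
    exact ⟨⟨s, fun {i} hi => h1 i hi, h2⟩, rfl⟩

/-- The product of `x_k ^ m_k / m_k!`, where `m_k` is the multiplicity of `k` in `s`. -/
def multisetWeight (x : ℕ → ℂ) (s : Multiset ℕ) : ℂ :=
  ∏ k ∈ s.toFinset, x k ^ s.count k / ((s.count k)! : ℂ)

theorem multisetWeight_eq_prod (x : ℕ → ℂ) {s : Multiset ℕ} {T : Finset ℕ} (h : s.toFinset ⊆ T) :
    multisetWeight x s = ∏ k ∈ T, x k ^ s.count k / ((s.count k)! : ℂ) := by
  refine Finset.prod_subset h fun k _ hk => ?_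
  rw [Multiset.mem_toFinset] at hk
  simp [Multiset.count_eq_zero_of_notMem hk]

theorem count_mul_multisetWeight (x : ℕ → ℂ) {s : Multiset ℕ} {k : ℕ} (hk : k ∈ s) :
    (s.count k : ℂ) * multisetWeight x s = x k * multisetWeight x (s.erase k) := by
  have hk' : k ∈ s.toFinset := Multiset.mem_toFinset.2 hk
  have hsub : (s.erase k).toFinset ⊆ s.toFinset :=
    Multiset.toFinset_subset.2 (Multiset.erase_subset k s)
  rw [multisetWeight_eq_prod x hsub, multisetWeight, ← Finset.mul_prod_erase _ _ hk',
    ← Finset.mul_prod_erase _ _ hk', Multiset.count_erase_self]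
  have h : ∏ i ∈ s.toFinset.erase k, x i ^ (s.erase k).count i / (((s.erase k).count i)! : ℂ) =
      ∏ i ∈ s.toFinset.erase k, x i ^ s.count i / ((s.count i)! : ℂ) :=
    Finset.prod_congr rfl fun i hi => by
      rw [Multiset.count_erase_of_ne (Finset.ne_of_mem_erase hi)]
  rw [h, ← mul_assoc, ← mul_assoc]
  congr 1
  obtain ⟨c, hc⟩ := Nat.exists_eq_succ_of_ne_zero (Multiset.count_ne_zero.2 hk)
  rw [hc, Nat.succ_eq_add_one, Nat.add_sub_cancel, Nat.factorial_succ, pow_succ]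
  have h1 : ((c : ℂ) + 1) ≠ 0 := Nat.cast_add_one_ne_zero c
  have h2 : ((c ! : ℕ) : ℂ) ≠ 0 := by exact_mod_cast Nat.factorial_ne_zero c
  push_cast
  field_simp

/-- The coefficient form of `E' = E x'`. The size `n + 1` of a partition is the sum of its distinct
parts `k` weighted by multiplicity, and removing one `k` trades the multiplicity for a factor `x k`.
-/
theorem sum_multisetWeight_succ (x : ℕ → ℂ) (n : ℕ) :
    ((n : ℂ) + 1) * ∑ s ∈ partitionFinset (n + 1), multisetWeight x s =
      ∑ p ∈ Finset.HasAntidiagonal.antidiagonal n,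
        (∑ s ∈ partitionFinset p.1, multisetWeight x s) * (x (p.2 + 1) * ((p.2 : ℂ) + 1)) := by
  have h1 : ((n : ℂ) + 1) * ∑ s ∈ partitionFinset (n + 1), multisetWeight x s =
      ∑ a ∈ (partitionFinset (n + 1)).sigma fun s => s.toFinset,
        multisetWeight x (a.1.erase a.2) * (x a.2 * (a.2 : ℂ)) := by
    rw [Finset.sum_sigma, Finset.mul_sum]
    refine Finset.sum_congr rfl fun s hs => ?_
    have hsum : ((n : ℂ) + 1) = ∑ k ∈ s.toFinset, (s.count k : ℂ) * (k : ℂ) := by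
      have := (mem_partitionFinset.1 hs).2
      rw [Finset.sum_multiset_count] at this
      have := congrArg (fun x : ℕ => (x : ℂ)) this
      push_cast at this
      rw [← this]
      simp
    rw [hsum, Finset.sum_mul]
    refine Finset.sum_congr rfl fun k hk => ?_
    have := count_mul_multisetWeight x (Multiset.mem_toFinset.1 hk)
    linear_combination (k : ℂ) * this
  have h2 : ∑ p ∈ Finset.HasAntidiagonal.antidiagonal n,
        (∑ s ∈ partitionFinset p.1, multisetWeight x s) * (x (p.2 + 1) * ((p.2 : ℂ) + 1)) =
      ∑ a ∈ (Finset.HasAntidiagonal.antidiagonal n).sigma fun p => partitionFinset p.1,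
        multisetWeight x a.2 * (x (a.1.2 + 1) * ((a.1.2 : ℂ) + 1)) := by
    rw [Finset.sum_sigma]
    exact Finset.sum_congr rfl fun p _ => Finset.sum_mul _ _ _
  rw [h1, h2]
  -- The second index is `k - 1`, matching the shift of degree in the derivative.
  refine Finset.sum_bij' (fun a _ => ⟨(n + 1 - a.2, a.2 - 1), a.1.erase a.2⟩)
    (fun a _ => ⟨(a.1.2 + 1) ::ₘ a.2, a.1.2 + 1⟩) ?_ ?_ ?_ ?_ ?_
  · rintro ⟨s, k⟩ h
    simp only [Finset.mem_sigma, Multiset.mem_toFinset, mem_partitionFinset,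
      Finset.HasAntidiagonal.mem_antidiagonal] at h ⊢
    obtain ⟨⟨hpos, hsum⟩, hk⟩ := h
    have hk0 := hpos k hk
    have hs := Multiset.sum_erase hk
    refine ⟨by omega, fun i hi => hpos i (Multiset.mem_of_mem_erase hi), by omega⟩
  · rintro ⟨⟨i, j⟩, t⟩ h
    simp only [Finset.mem_sigma, Multiset.mem_toFinset, mem_partitionFinset,
      Finset.HasAntidiagonal.mem_antidiagonal, Multiset.mem_cons, Multiset.sum_cons] at h ⊢
    obtain ⟨hij, hpos, hsum⟩ := h
    refine ⟨⟨?_, by omega⟩, Or.inl trivial⟩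
    rintro a (rfl | ha)
    · omega
    · exact hpos a ha
  · rintro ⟨s, k⟩ h
    simp only [Finset.mem_sigma, Multiset.mem_toFinset, mem_partitionFinset] at h
    obtain ⟨⟨hpos, hsum⟩, hk⟩ := h
    have hk0 := hpos k hk
    simp only [Nat.sub_add_cancel hk0, Multiset.cons_erase hk]
  · rintro ⟨⟨i, j⟩, t⟩ h
    simp only [Finset.mem_sigma, Finset.HasAntidiagonal.mem_antidiagonal] at h
    have : n + 1 - (j + 1) = i := by omega
    simp only [Multiset.erase_cons_head, this, Nat.add_sub_cancel]
  · rintro ⟨s, k⟩ h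
    simp only [Finset.mem_sigma, Multiset.mem_toFinset, mem_partitionFinset] at h
    have hk0 := h.1.1 k h.2
    have h3 : ((k - 1 : ℕ) : ℂ) + 1 = k := by
      exact_mod_cast congrArg (fun x : ℕ => (x : ℂ)) (Nat.sub_add_cancel hk0)
    simp only [Nat.sub_add_cancel hk0, h3]

theorem sum_multisetWeight_eq_coeff {x : ℕ → ℂ} (hx : x 0 = 0) (n : ℕ) :
    ∑ s ∈ partitionFinset n, multisetWeight x s =
      PowerSeries.coeff n (expSeries (PowerSeries.mk x)) := by
  have h : PowerSeries.mk (fun n => ∑ s ∈ partitionFinset n, multisetWeight x s) =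
      expSeries (PowerSeries.mk x) := by
    refine eq_expSeries ?_ ?_ ?_
    · simpa [← PowerSeries.coeff_zero_eq_constantCoeff_apply] using hx
    · have h0 : partitionFinset 0 = {0} := by
        ext s
        rw [mem_partitionFinset, Finset.mem_singleton]
        constructor
        · rintro ⟨h1, h2⟩
          refine Multiset.eq_zero_of_forall_notMem fun i hi => ?_
          have := Multiset.le_sum_of_mem hi
          have := h1 i hi
          omega
        · rintro rfl
          simp
      simp [← PowerSeries.coeff_zero_eq_constantCoeff_apply, h0, multisetWeight]
    · ext n
      rw [PowerSeries.coeff_mul]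
      simp only [PowerSeries.coeff_derivative, PowerSeries.coeff_mk]
      rw [mul_comm, sum_multisetWeight_succ]
  rw [← h, PowerSeries.coeff_mk]

/-- Cauchy's count of a conjugacy class. `cycleType` omits fixed points while the partition records
them as ones, so the ones are split off from `s`. -/
theorem card_parts_eq_mul {N : ℕ} {s : Multiset ℕ} (hs : s ∈ partitionFinset N) :
    (Finset.univ.filter fun σ : Equiv.Perm (Fin N) => σ.partition.parts = s).card *
      ∏ k ∈ s.toFinset, k ^ s.count k * (s.count k)! = N ! := by
  obtain ⟨hpos, hsum⟩ := mem_partitionFinset.1 hs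
  set m := s.filter fun n => 2 ≤ n with hm
  have hs' : s = Multiset.replicate (s.count 1) 1 + m := by
    rw [← Multiset.filter_eq', add_comm, hm]
    conv_lhs => rw [← Multiset.filter_add_not (fun n => 2 ≤ n) s]
    congr 1
    refine Multiset.filter_congr fun a ha => ?_
    have := hpos a ha
    omega
  have hmsum : s.count 1 + m.sum = N := by
    have h := congrArg Multiset.sum hs'
    rw [Multiset.sum_add, Multiset.sum_replicate, hsum] at h
    simpa using h.symm
  have hset : (Finset.univ.filter fun σ : Equiv.Perm (Fin N) => σ.partition.parts = s) =
      Finset.univ.filter fun σ : Equiv.Perm (Fin N) => σ.cycleType = m := by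
    refine Finset.filter_congr fun σ _ => ?_
    constructor
    · rintro rfl
      exact Equiv.Perm.filter_parts_partition_eq_cycleType.symm
    · intro h
      rw [Equiv.Perm.parts_partition, ← Equiv.Perm.sum_cycleType, h, hs', add_comm, Fintype.card_fin]
      congr 2
      omega
  have hcard := Equiv.Perm.card_of_cycleType_mul_eq (Fin N) m
  rw [if_pos ⟨by rw [Fintype.card_fin]; omega, fun a ha => (Multiset.mem_filter.1 ha).2⟩,
    Fintype.card_fin] at hcard
  rw [hset, ← hcard]
  congr 1
  rw [Finset.prod_mul_distrib, ← Finset.prod_multiset_count]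
  have hprod : s.prod = m.prod := by
    conv_lhs => rw [hs']
    simp
  have hN : N - m.sum = s.count 1 := by omega
  have hfact : ∏ k ∈ s.toFinset, (s.count k)! = (s.count 1)! * ∏ k ∈ m.toFinset, (m.count k)! := by
    have h1 : ∏ k ∈ s.toFinset, (s.count k)! = ∏ k ∈ insert 1 m.toFinset, (s.count k)! := by
      refine Finset.prod_subset ?_ ?_
      · intro a ha
        rw [Multiset.mem_toFinset, hs', Multiset.mem_add] at ha
        rcases ha with ha | ha
        · simp [Multiset.eq_of_mem_replicate ha]
        · simp [ha]
      · intro a _ ha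
        rw [Multiset.mem_toFinset] at ha
        simp [Multiset.count_eq_zero_of_notMem ha]
    rw [h1, Finset.prod_insert (by simp [hm])]
    congr 1
    refine Finset.prod_congr rfl fun k hk => ?_
    rw [hm, Multiset.count_filter_of_pos]
    exact (Multiset.mem_filter.1 (Multiset.mem_toFinset.1 hk)).2
  rw [hprod, hN, hfact]
  ring

/-- The exponential formula for the symmetric group. -/
theorem sum_perm_prod_cycleCount (w : ℕ → ℂ) (N : ℕ) :
    (∑ σ : Equiv.Perm (Fin N), ∏ k ∈ Finset.Icc 1 N, w k ^ cycleCount σ k) / (N ! : ℂ) =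
      PowerSeries.coeff N (expSeries (PowerSeries.mk fun k : ℕ => w k / (k : ℂ))) := by
  rw [← sum_multisetWeight_eq_coeff (by simp)]
  have hmaps : ∀ σ ∈ (Finset.univ : Finset (Equiv.Perm (Fin N))),
      σ.partition.parts ∈ partitionFinset N := fun σ _ =>
    mem_partitionFinset.2 ⟨fun i hi => σ.partition.parts_pos hi,
      σ.partition.parts_sum.trans (Fintype.card_fin N)⟩
  -- The weight depends only on the cycle shape, so permutations are grouped by shape.
  rw [← Finset.sum_fiberwise_of_maps_to hmaps, Finset.sum_div]
  refine Finset.sum_congr rfl fun s hs => ?_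
  have hsub : s.toFinset ⊆ Finset.Icc 1 N := by
    intro k hk
    rw [Multiset.mem_toFinset] at hk
    obtain ⟨hpos, hsum⟩ := mem_partitionFinset.1 hs
    exact Finset.mem_Icc.2 ⟨hpos k hk, hsum ▸ Multiset.le_sum_of_mem hk⟩
  have hconst : ∀ σ ∈ Finset.univ.filter fun σ : Equiv.Perm (Fin N) => σ.partition.parts = s,
      ∏ k ∈ Finset.Icc 1 N, w k ^ cycleCount σ k = ∏ k ∈ s.toFinset, w k ^ s.count k := by
    intro σ hσ
    rw [Finset.mem_filter] at hσ
    simp only [cycleCount, hσ.2]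
    refine (Finset.prod_subset hsub fun k _ hk => ?_).symm
    rw [Multiset.mem_toFinset] at hk
    simp [Multiset.count_eq_zero_of_notMem hk]
  rw [Finset.sum_congr rfl hconst, Finset.sum_const, nsmul_eq_mul, ← card_parts_eq_mul hs,
    multisetWeight]
  have hne : ((∏ k ∈ s.toFinset, k ^ s.count k * (s.count k)! : ℕ) : ℂ) ≠ 0 := by
    rw [Nat.cast_ne_zero, Finset.prod_ne_zero_iff]
    intro k hk
    have := (mem_partitionFinset.1 hs).1 k (Multiset.mem_toFinset.1 hk)
    positivity
  have hcard : ((Finset.univ.filter fun σ : Equiv.Perm (Fin N) =>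
      σ.partition.parts = s).card : ℂ) ≠ 0 := by
    intro h
    have := card_parts_eq_mul hs
    rw [Nat.cast_eq_zero.1 h, zero_mul] at this
    exact Nat.factorial_ne_zero N this.symm
  rw [Nat.cast_mul, mul_div_mul_left _ _ hcard, Nat.cast_prod, ← Finset.prod_div_distrib]
  refine Finset.prod_congr rfl fun k _ => ?_
  push_cast
  rw [div_pow, div_div]

/-! ### Decomposition of a permutation into rotations -/

theorem cycleType_sigmaCongrRight_mulSingle {ι : Type*} [Fintype ι] [DecidableEq ι] {β : ι → Type*}
    [∀ i, Fintype (β i)] [∀ i, DecidableEq (β i)] (i : ι) (g : Equiv.Perm (β i)) :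
    (Equiv.Perm.sigmaCongrRightHom β (Pi.mulSingle i g)).cycleType = g.cycleType := by
  rw [← Equiv.Perm.cycleType_extendDomain
    (Equiv.sigmaSubtype i).symm (p := fun s : Sigma β => s.1 = i) (g := g)]
  congr 1
  ext1 ⟨j, x⟩
  by_cases h : j = i
  · subst h
    rw [show (⟨j, x⟩ : Sigma β) = ((Equiv.sigmaSubtype j).symm x : {s : Sigma β // s.1 = j}) from rfl,
      Equiv.Perm.extendDomain_apply_image]
    simp [Equiv.sigmaSubtype]
  · rw [Equiv.Perm.extendDomain_apply_not_subtype (p := fun s : Sigma β => s.1 = i) (b := ⟨j, x⟩) _ _ h]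
    simp [Pi.mulSingle_eq_of_ne h]

/-- The fibres are added one at a time; permutations supported on different fibres are disjoint, so
their cycle types add. -/
theorem cycleType_sigmaCongrRight {ι : Type*} [Fintype ι] [DecidableEq ι] {β : ι → Type*}
    [∀ i, Fintype (β i)] [∀ i, DecidableEq (β i)] (g : ∀ i, Equiv.Perm (β i)) :
    (Equiv.Perm.sigmaCongrRight g : Equiv.Perm (Sigma β)).cycleType = ∑ i, (g i).cycleType := by
  have key : ∀ s : Finset ι, (Equiv.Perm.sigmaCongrRightHom β
      (fun i => if i ∈ s then g i else 1)).cycleType = ∑ i ∈ s, (g i).cycleType := by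
    intro s
    induction s using Finset.induction_on with
    | empty =>
      have : (fun i => if i ∈ (∅ : Finset ι) then g i else 1) = 1 := by
        funext i
        simp
      rw [this, map_one]
      simp
    | insert a s ha ih =>
      have h : (fun i => if i ∈ insert a s then g i else 1) =
          Pi.mulSingle a (g a) * fun i => if i ∈ s then g i else 1 := by
        funext i
        by_cases hi : i = a
        · subst hi
          simp [ha]
        · simp [hi]
      rw [h, map_mul, Equiv.Perm.Disjoint.cycleType_mul, ih, cycleType_sigmaCongrRight_mulSingle,
        Finset.sum_insert ha]
      rintro ⟨j, x⟩
      by_cases hj : j = a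
      · subst hj
        right
        simp [ha]
      · left
        simp [hj]
  have := key Finset.univ
  simpa using this

/-- A disjoint union of rotations with the cycle lengths of `σ` has the cycle type of `σ`, hence is
conjugate to it. The conjugating permutation corrects the arbitrary labelling `e₀`. -/
theorem exists_rotation_decomposition {N : ℕ} (σ : Equiv.Perm (Fin N)) :
    ∃ (l : ℕ) (k : Fin l → ℕ) (e : (Σ i, Fin (k i)) ≃ Fin N), (∀ i, 0 < k i) ∧
      (∀ a, σ (e a) = e ⟨a.1, finRotate (k a.1) a.2⟩) ∧
      (Finset.univ : Finset (Fin l)).val.map k = σ.partition.parts := by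
  set L := σ.partition.parts.toList with hL
  have hparts : (Finset.univ : Finset (Fin L.length)).val.map L.get = σ.partition.parts := by
    rw [Fin.univ_val_map, List.ofFn_get, hL, Multiset.coe_toList]
  have hcard : Fintype.card (Σ i : Fin L.length, Fin (L.get i)) = Fintype.card (Fin N) := by
    rw [Fintype.card_sigma]
    simp only [Fintype.card_fin]
    have := congrArg Multiset.sum hparts
    rw [σ.partition.parts_sum, Fintype.card_fin] at this
    exact this
  let e₀ := Fintype.equivOfCardEq hcard
  let τ : Equiv.Perm (Fin N) :=
    e₀.permCongr (Equiv.Perm.sigmaCongrRight fun i => finRotate (L.get i))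
  have hpos : ∀ i, 0 < L.get i := fun i =>
    σ.partition.parts_pos (Multiset.mem_toList.1 (List.get_mem L i))
  have hτ : τ.cycleType = σ.cycleType := by
    have h1 : τ = (Equiv.Perm.sigmaCongrRight fun i => finRotate (L.get i)).extendDomain
        (e₀.trans (Equiv.Set.univ (Fin N)).symm : _ ≃ {x : Fin N // x ∈ Set.univ}) := by
      ext1 x
      rw [Equiv.Perm.extendDomain_apply_subtype _ _ (Set.mem_univ x)]
      rfl
    rw [h1, Equiv.Perm.cycleType_extendDomain, cycleType_sigmaCongrRight,
      ← Equiv.Perm.filter_parts_partition_eq_cycleType, ← hparts, Multiset.filter_map,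
      ← Multiset.sum_map_singleton (Multiset.map _ _), Multiset.map_map]
    have h2 (i : Fin L.length) : (finRotate (L.get i)).cycleType =
        if 2 ≤ L.get i then {L.get i} else 0 := by
      split_ifs with h
      · exact cycleType_finRotate_of_le h
      · have h1 : L.get i = 1 := by
          have := hpos i
          omega
        rw [h1, finRotate_one]
        exact Equiv.Perm.cycleType_one
    simp only [h2]
    rw [← Finset.sum_filter]
    rfl
  obtain ⟨c, hc⟩ := isConj_iff.1 (Equiv.Perm.isConj_iff_cycleType_eq.2 hτ)
  refine ⟨L.length, L.get, e₀.trans c, hpos, fun a => ?_, hparts⟩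
  rw [← hc]
  simp [τ]

/-! ### The characteristic polynomial and the trace of a function -/

/-- `X ^ k - y` is separable, so having all its `k` distinct roots forces divisibility, and equality
by degree. Exhibiting eigenvectors thus replaces expanding a determinant. -/
theorem eq_X_pow_sub_C_of_isRoot {k : ℕ} (hk : 0 < k) {y : ℂ} (hy : y ≠ 0) {p : Polynomial ℂ}
    (hp : p.Monic) (hdeg : p.natDegree = k) (hroot : ∀ ω : ℂ, ω ^ k = y → p.IsRoot ω) :
    p = Polynomial.X ^ k - Polynomial.C y := by
  have hq : (Polynomial.X ^ k - Polynomial.C y).Monic := Polynomial.monic_X_pow_sub_C y hk.ne'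
  have hsep : (Polynomial.X ^ k - Polynomial.C y).Separable :=
    Polynomial.separable_X_pow_sub_C y (by exact_mod_cast hk.ne') hy
  have hdvd : Polynomial.X ^ k - Polynomial.C y ∣ p := by
    rw [IsAlgClosed.dvd_iff_roots_le_roots hq.ne_zero hp.ne_zero,
      Multiset.le_iff_subset (Polynomial.nodup_roots hsep)]
    intro ω hω
    refine (Polynomial.mem_roots hp.ne_zero).2 (hroot ω ?_)
    have := (Polynomial.mem_roots'.1 hω).2
    simpa [Polynomial.IsRoot, sub_eq_zero] using this
  exact (Polynomial.eq_of_monic_of_dvd_of_natDegree_le hq hp hdvd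
    (by rw [hdeg, Polynomial.natDegree_X_pow_sub_C]))

theorem charpoly_rotation {k : ℕ} (hk : 0 < k) (z : Fin k → ℂ) (hz : ∀ i, z i ≠ 0) :
    (Matrix.of fun i j : Fin k => if i = finRotate k j then z i else 0).charpoly =
      Polynomial.X ^ k - Polynomial.C (∏ i, z i) := by
  refine eq_X_pow_sub_C_of_isRoot hk (Finset.prod_ne_zero_iff.2 fun i _ => hz i)
    (Matrix.charpoly_monic _) (by rw [Matrix.charpoly_natDegree_eq_dim, Fintype.card_fin]) ?_
  intro ω hω
  obtain ⟨n, rfl⟩ := Nat.exists_eq_succ_of_ne_zero hk.ne'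
  have hω0 : ω ≠ 0 := by
    rintro rfl
    rw [zero_pow hk.ne'] at hω
    exact Finset.prod_ne_zero_iff.2 (fun i _ => hz i) hω.symm
  rw [Polynomial.IsRoot, Matrix.eval_charpoly]
  -- The eigenvector starts at `1` and is multiplied by `z i / ω` at each step along the cycle.
  -- Closing up the cycle is exactly the condition `ω ^ k = ∏ z i`.
  refine Matrix.exists_mulVec_eq_zero_iff.1
    ⟨Fin.partialProd fun i : Fin n => z i.succ / ω, fun h => ?_, ?_⟩
  · have := congrFun h 0
    simp at this
  · have hstep : ∀ j : Fin (n + 1), ω * Fin.partialProd (fun i : Fin n => z i.succ / ω)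
        (finRotate (n + 1) j) = z (finRotate (n + 1) j) *
          Fin.partialProd (fun i : Fin n => z i.succ / ω) j := by
      intro j
      induction j using Fin.lastCases with
      | last =>
        rw [finRotate_last, Fin.partialProd_zero, Fin.partialProd, Fin.val_last,
          List.take_of_length_le (by simp), List.prod_ofFn, Finset.prod_div_distrib,
          Finset.prod_const, Finset.card_univ, Fintype.card_fin, mul_one, ← mul_div_assoc,
          ← Fin.prod_univ_succ, ← hω, Nat.succ_eq_add_one, pow_succ]
        field_simp
      | cast j =>
        have : finRotate (n + 1) j.castSucc = j.succ := by
          rw [finRotate_apply, Fin.coeSucc_eq_succ]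
        rw [this, Fin.partialProd_succ]
        field_simp
    funext i
    obtain ⟨j, rfl⟩ := (finRotate (n + 1)).surjective i
    have h := hstep j
    simp [Matrix.mulVec, dotProduct, Matrix.diagonal_apply,
      Matrix.scalar_apply, sub_mul, Finset.sum_sub_distrib, ite_mul, sub_eq_zero]
    simpa using h

/-- The matrix is block diagonal along the cycles; block triangularity suffices to factor the
characteristic polynomial. -/
theorem charpoly_sigma {l : ℕ} {k : Fin l → ℕ} (hk : ∀ i, 0 < k i)
    (z : (Σ i, Fin (k i)) → ℂ) (hz : ∀ a, z a ≠ 0) :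
    (Matrix.of fun a b : (Σ i, Fin (k i)) =>
      if a = ⟨b.1, finRotate (k b.1) b.2⟩ then z a else 0).charpoly =
      ∏ i, (Polynomial.X ^ k i - Polynomial.C (∏ j, z ⟨i, j⟩)) := by
  set M := Matrix.of fun a b : (Σ i, Fin (k i)) =>
      if a = ⟨b.1, finRotate (k b.1) b.2⟩ then z a else 0 with hM
  have hB : M.BlockTriangular Sigma.fst := by
    intro a b hab
    simp only [hM, Matrix.of_apply]
    refine if_neg fun h => ?_
    rw [h] at hab
    exact lt_irrefl _ hab
  have himg : Finset.univ.image (Sigma.fst : (Σ i, Fin (k i)) → Fin l) = Finset.univ := by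
    refine Finset.eq_univ_of_forall fun i => Finset.mem_image.2 ⟨⟨i, ⟨0, hk i⟩⟩, Finset.mem_univ _, rfl⟩
  rw [hB.charpoly, himg]
  refine Finset.prod_congr rfl fun i _ => ?_
  rw [← charpoly_rotation (hk i) (fun j => z ⟨i, j⟩) fun j => hz _,
    ← Matrix.charpoly_reindex (Equiv.sigmaSubtype i)]
  congr 1
  ext a b
  change (if (⟨i, a⟩ : Σ i, Fin (k i)) = ⟨i, finRotate (k i) b⟩ then z ⟨i, a⟩ else 0) =
    if a = finRotate (k i) b then z ⟨i, a⟩ else 0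
  simp only [Sigma.mk.injEq, heq_eq_eq, true_and]

theorem charpoly_wreathMatrix {N : ℕ} (x : Equiv.Perm (Fin N) × (Fin N → Circle)) {l : ℕ}
    {k : Fin l → ℕ} (hk : ∀ i, 0 < k i) (e : (Σ i, Fin (k i)) ≃ Fin N)
    (he : ∀ a, x.1 (e a) = e ⟨a.1, finRotate (k a.1) a.2⟩) :
    (wreathMatrix x).charpoly =
      ∏ i, (Polynomial.X ^ k i - Polynomial.C ((∏ j, x.2 (e ⟨i, j⟩) : Circle) : ℂ)) := by
  have h := charpoly_sigma hk (fun a => (x.2 (e a) : ℂ)) fun a => Circle.coe_ne_zero _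
  rw [← Matrix.charpoly_reindex e] at h
  have hM : wreathMatrix x = Matrix.reindex e e (Matrix.of fun a b : (Σ i, Fin (k i)) =>
      if a = ⟨b.1, finRotate (k b.1) b.2⟩ then ((x.2 (e a) : Circle) : ℂ) else 0) := by
    ext i j
    obtain ⟨a, rfl⟩ := e.surjective i
    obtain ⟨b, rfl⟩ := e.surjective j
    simp [wreathMatrix, he]
  rw [hM, h]
  refine Finset.prod_congr rfl fun i _ => ?_
  congr 2
  exact (map_prod Circle.coeHom _ _).symm

/-- There are finitely many `k`-th roots of a point of the circle. -/
theorem finite_setOf_pow_eq {k : ℕ} (hk : 0 < k) (y : Circle) : {ω : Circle | ω ^ k = y}.Finite := by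
  have h : {ω : Circle | ω ^ k = y} ⊆
      (fun ω : Circle => (ω : ℂ)) ⁻¹' {ω | ω ∈ Polynomial.nthRoots k (y : ℂ)} := by
    intro ω hω
    rw [Set.mem_preimage, Set.mem_ofPred_eq, Polynomial.mem_nthRoots hk, ← Circle.coe_pow]
    exact congrArg _ hω
  refine (Set.Finite.preimage (Circle.coe_injective.injOn) ?_).subset h
  exact Multiset.finite_toSet _

theorem mul_rootAverage (F : Circle → ℂ) {k : ℕ} (hk : 0 < k) (y : Circle) :
    (k : ℂ) * rootAverage F k y = ∑ᶠ ω ∈ {ω : Circle | ω ^ k = y}, F ω := by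
  have : (k : ℂ) ≠ 0 := by exact_mod_cast hk.ne'
  rw [rootAverage, one_div, mul_inv_cancel_left₀ this]

theorem rootMultiplicity_X_pow_sub_C {k : ℕ} (hk : 0 < k) {y : ℂ} (hy : y ≠ 0) (ω : ℂ) :
    (Polynomial.X ^ k - Polynomial.C y).rootMultiplicity ω = if ω ^ k = y then 1 else 0 := by
  classical
  have hq : (Polynomial.X ^ k - Polynomial.C y).Monic := Polynomial.monic_X_pow_sub_C y hk.ne'
  have hsep : (Polynomial.X ^ k - Polynomial.C y).Separable :=
    Polynomial.separable_X_pow_sub_C y (by exact_mod_cast hk.ne') hy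
  rw [← Polynomial.count_roots, Multiset.count_eq_of_nodup (Polynomial.nodup_roots hsep)]
  refine if_congr ?_ rfl rfl
  rw [Polynomial.mem_roots hq.ne_zero]
  simp [Polynomial.IsRoot, sub_eq_zero]

/-- Root multiplicities add over the factors of the characteristic polynomial, and each factor `X ^
k - y` has simple roots. -/
theorem wreathTrace_eq_sum (F : Circle → ℂ) {N : ℕ} (x : Equiv.Perm (Fin N) × (Fin N → Circle))
    {l : ℕ} {k : Fin l → ℕ} (hk : ∀ i, 0 < k i) (e : (Σ i, Fin (k i)) ≃ Fin N)
    (he : ∀ a, x.1 (e a) = e ⟨a.1, finRotate (k a.1) a.2⟩) :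
    wreathTrace F x = ∑ i, (k i : ℂ) * rootAverage F (k i) (∏ j, x.2 (e ⟨i, j⟩)) := by
  classical
  have hmult (ω : Circle) : ((wreathMatrix x).charpoly.rootMultiplicity (ω : ℂ) : ℂ) * F ω =
      ∑ i, Set.indicator {ω : Circle | ω ^ k i = ∏ j, x.2 (e ⟨i, j⟩)} F ω := by
    rw [charpoly_wreathMatrix x hk e he, ← Polynomial.count_roots, Polynomial.roots_prod,
      Multiset.count_bind, ← Finset.sum_eq_multiset_sum, Nat.cast_sum, Finset.sum_mul]
    · refine Finset.sum_congr rfl fun i _ => ?_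
      rw [Polynomial.count_roots, rootMultiplicity_X_pow_sub_C (hk i) (Circle.coe_ne_zero _),
        Set.indicator_apply, ← Circle.coe_pow]
      simp only [Circle.coe_inj, Set.mem_ofPred_eq]
      split_ifs <;> simp
    · exact Finset.prod_ne_zero_iff.2 fun i _ =>
        (Polynomial.monic_X_pow_sub_C _ (hk i).ne').ne_zero
  rw [wreathTrace, finsum_congr hmult, finsum_sum_comm]
  · refine Finset.sum_congr rfl fun i _ => ?_
    rw [mul_rootAverage F (hk i), finsum_mem_def]
  · intro i _
    exact (finite_setOf_pow_eq (hk i) _).subset Set.support_indicator_subset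

/-! ### Measurability -/

/-- The argument gives a measurable choice of a `k`-th root of `y`. The set of all roots is its
translate by the `k`-th roots of unity, so the sum runs over a fixed finite set. -/
theorem measurable_mul_rootAverage {F : Circle → ℂ} (hF : Measurable F) (k : ℕ) :
    Measurable fun y => (k : ℂ) * rootAverage F k y := by
  rcases Nat.eq_zero_or_pos k with rfl | hk
  · simp only [Nat.cast_zero, zero_mul]
    exact measurable_const
  have hρ : ∀ y : Circle, Circle.exp (Complex.arg y / k) ^ k = y := by
    intro y
    have : (k : ℝ) ≠ 0 := by exact_mod_cast hk.ne'
    rw [← Circle.exp_nsmul, nsmul_eq_mul, mul_div_cancel₀ _ this, Circle.exp_arg]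
  have h : (fun y => (k : ℂ) * rootAverage F k y) = fun y : Circle =>
      ∑ ζ ∈ (finite_setOf_pow_eq hk 1).toFinset, F (ζ * Circle.exp (Complex.arg y / k)) := by
    funext y
    rw [mul_rootAverage F hk, finsum_mem_eq_finite_toFinset_sum _ (finite_setOf_pow_eq hk y)]
    refine Finset.sum_bij' (fun ω _ => ω * (Circle.exp (Complex.arg y / k))⁻¹)
      (fun ζ _ => ζ * Circle.exp (Complex.arg y / k)) ?_ ?_ ?_ ?_ ?_
    · intro ω hω
      simp only [Set.Finite.mem_toFinset, Set.mem_ofPred_eq] at hω ⊢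
      rw [mul_pow, hω, inv_pow, hρ, mul_inv_cancel]
    · intro ζ hζ
      simp only [Set.Finite.mem_toFinset, Set.mem_ofPred_eq] at hζ ⊢
      rw [mul_pow, hζ, hρ, one_mul]
    · intro ω _
      simp
    · intro ζ _
      simp
    · intro ω _
      simp
  rw [h]
  refine Finset.measurable_sum _ fun ζ _ => hF.comp ?_
  have h1 : Measurable fun y : Circle => Complex.arg y / k :=
    (Complex.measurable_arg.comp (by fun_prop : Continuous fun y : Circle => (y : ℂ)).measurable).div_const _
  have h2 : Measurable fun t : ℝ => ζ * Circle.exp t := by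
    have : Continuous fun t : ℝ => ζ * Circle.exp t := by fun_prop
    exact this.measurable
  exact h2.comp h1

theorem measurable_wreathTrace {F : Circle → ℂ} (hF : Measurable F) (N : ℕ) :
    Measurable fun x : Equiv.Perm (Fin N) × (Fin N → Circle) => wreathTrace F x := by
  refine measurable_from_prod_countable_right fun σ => ?_
  obtain ⟨l, k, e, hk, he, -⟩ := exists_rotation_decomposition σ
  have h : (fun z => wreathTrace F (σ, z)) = fun z : Fin N → Circle =>
      ∑ i, (k i : ℂ) * rootAverage F (k i) (∏ j, z (e ⟨i, j⟩)) :=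
    funext fun z => wreathTrace_eq_sum F (σ, z) hk e he
  rw [h]
  refine Finset.measurable_sum _ fun i _ => (measurable_mul_rootAverage hF (k i)).comp ?_
  exact Finset.measurable_prod _ fun j _ => measurable_pi_apply _

/-! ### The characteristic function of the trace -/

instance isProbabilityMeasure_cycleLaw (ν : Measure Circle) [IsProbabilityMeasure ν] (k : ℕ) :
    IsProbabilityMeasure (cycleLaw ν k) :=
  Measure.isProbabilityMeasure_map
    (Finset.measurable_prod _ fun j _ => measurable_pi_apply j).aemeasurable

theorem map_pi_sigma {l : ℕ} {k : Fin l → ℕ} (ν : Measure Circle) [IsProbabilityMeasure ν] :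
    (Measure.pi fun _ : (Σ i, Fin (k i)) => ν).map
        (MeasurableEquiv.piCurry fun (i : Fin l) (_ : Fin (k i)) => Circle) =
      Measure.pi fun i => Measure.pi fun _ : Fin (k i) => ν := by
  have h := Measure.infinitePi_map_piCurry (fun (i : Fin l) (_ : Fin (k i)) => ν)
  simpa only [Measure.infinitePi_eq_pi] using h

/-- Different cycles use disjoint sets of coordinates, so Fubini splits the integral over blocks. -/
theorem integral_prod_blocks {N l : ℕ} {k : Fin l → ℕ} (e : (Σ i, Fin (k i)) ≃ Fin N)
    (ν : Measure Circle) [IsProbabilityMeasure ν] (f : Fin l → Circle → ℂ)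
    (hf : ∀ i, Measurable (f i)) :
    ∫ z : Fin N → Circle, ∏ i, f i (∏ j, z (e ⟨i, j⟩)) ∂Measure.pi (fun _ => ν) =
      ∏ i, ∫ y, f i y ∂cycleLaw ν (k i) := by
  have h1 := (measurePreserving_piCongrLeft (fun _ : Fin N => ν) e).integral_comp'
    (fun z : Fin N → Circle => ∏ i, f i (∏ j, z (e ⟨i, j⟩)))
  rw [← h1]
  simp only [MeasurableEquiv.coe_piCongrLeft, Equiv.piCongrLeft_apply_apply]
  have h2 : ∫ u : (∀ i, Fin (k i) → Circle), ∏ i, f i (∏ j, u i j)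
        ∂(Measure.pi fun i => Measure.pi fun _ : Fin (k i) => ν) =
      ∫ w : (Σ i, Fin (k i)) → Circle, ∏ i, f i (∏ j, w ⟨i, j⟩) ∂Measure.pi (fun _ => ν) := by
    rw [← map_pi_sigma, integral_map_equiv]
    rfl
  rw [← h2, integral_fintype_prod_eq_prod (fun i (u : Fin (k i) → Circle) => f i (∏ j, u j))]
  refine Finset.prod_congr rfl fun i _ => ?_
  rw [cycleLaw, integral_map
    (Finset.measurable_prod _ fun j _ => measurable_pi_apply j).aemeasurable
    (hf i).aestronglyMeasurable]

/-- The character `X ↦ exp(i Re(s̄ X))` of `ℂ`. -/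
def complexChar (s X : ℂ) : ℂ := Complex.exp (Complex.I * (((starRingEnd ℂ) s * X).re : ℂ))

theorem continuous_complexChar (s : ℂ) : Continuous (complexChar s) := by
  unfold complexChar
  fun_prop

theorem norm_complexChar (s X : ℂ) : ‖complexChar s X‖ = 1 := by
  rw [complexChar, mul_comm]
  exact Complex.norm_exp_ofReal_mul_I _

theorem complexChar_zero (s : ℂ) : complexChar s 0 = 1 := by simp [complexChar]

theorem complexChar_add (s X Y : ℂ) : complexChar s (X + Y) = complexChar s X * complexChar s Y := by
  simp only [complexChar, ← Complex.exp_add, mul_add, Complex.add_re, Complex.ofReal_add]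

theorem complexChar_sum {ι : Type*} (s : ℂ) (t : Finset ι) (X : ι → ℂ) :
    complexChar s (∑ i ∈ t, X i) = ∏ i ∈ t, complexChar s (X i) := by
  classical
  induction t using Finset.induction_on with
  | empty => simp [complexChar_zero]
  | insert a t ha ih => rw [Finset.sum_insert ha, Finset.prod_insert ha, complexChar_add, ih]

theorem norm_complexChar_sub_one_le (s X : ℂ) : ‖complexChar s X - 1‖ ≤ ‖s‖ * ‖X‖ := by
  rw [complexChar]
  refine (Real.norm_exp_I_mul_ofReal_sub_one_le).trans ?_
  rw [Real.norm_eq_abs]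
  refine (Complex.abs_re_le_norm _).trans_eq ?_
  rw [norm_mul, RCLike.norm_conj]

theorem integral_complexChar_wreathTrace {F : Circle → ℂ} (hF : Measurable F)
    (ν : Measure Circle) [IsProbabilityMeasure ν] (s : ℂ) {N : ℕ} (σ : Equiv.Perm (Fin N)) :
    ∫ z, complexChar s (wreathTrace F (σ, z)) ∂Measure.pi (fun _ => ν) =
      ∏ k ∈ Finset.Icc 1 N, cycleChar F ν k s ^ cycleCount σ k := by
  obtain ⟨l, k, e, hk, he, hparts⟩ := exists_rotation_decomposition σ
  have h (z : Fin N → Circle) : complexChar s (wreathTrace F (σ, z)) =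
      ∏ i, complexChar s ((k i : ℂ) * rootAverage F (k i) (∏ j, z (e ⟨i, j⟩))) := by
    rw [wreathTrace_eq_sum F (σ, z) hk e he, complexChar_sum]
  simp only [h]
  rw [integral_prod_blocks e ν fun i y => complexChar s ((k i : ℂ) * rootAverage F (k i) y)]
  · have hsub : σ.partition.parts.toFinset ⊆ Finset.Icc 1 N := by
      intro k hk
      rw [Multiset.mem_toFinset] at hk
      refine Finset.mem_Icc.2 ⟨σ.partition.parts_pos hk, ?_⟩
      exact (Multiset.le_sum_of_mem hk).trans_eq (σ.partition.parts_sum.trans (Fintype.card_fin N))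
    have h1 : ∏ k ∈ Finset.Icc 1 N, cycleChar F ν k s ^ cycleCount σ k =
        ∏ k ∈ σ.partition.parts.toFinset, cycleChar F ν k s ^ σ.partition.parts.count k := by
      refine (Finset.prod_subset hsub fun k _ hk => ?_).symm
      rw [Multiset.mem_toFinset] at hk
      simp [cycleCount, Multiset.count_eq_zero_of_notMem hk]
    rw [h1, ← Finset.prod_multiset_map_count, ← hparts, Multiset.map_map]
    rfl
  · exact fun i => (continuous_complexChar s).measurable.comp (measurable_mul_rootAverage hF (k i))

theorem ewensNorm_mul_factorial (θ : ℕ → ℝ) (N : ℕ) :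
    ewensNorm θ N * (N ! : ℝ) = ∑ σ : Equiv.Perm (Fin N), ewensWeight θ σ := by
  have hN : (N ! : ℝ) ≠ 0 := by exact_mod_cast Nat.factorial_ne_zero N
  rw [ewensNorm]
  field_simp

theorem charFunction_wreathTrace_eq_sum {θ : ℕ → ℝ} (hθ : ∀ k, 1 ≤ k → 0 < θ k)
    {F : Circle → ℂ} (hF : Measurable F) (ν : Measure Circle) [IsProbabilityMeasure ν]
    (s : ℂ) (N : ℕ) :
    charFunction (wreathMeasure θ ν N) (fun x => wreathTrace F x) s =
      (∑ σ : Equiv.Perm (Fin N), ∏ k ∈ Finset.Icc 1 N,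
        ((θ k : ℂ) * cycleChar F ν k s) ^ cycleCount σ k) /
      ∑ σ : Equiv.Perm (Fin N), ∏ k ∈ Finset.Icc 1 N, (θ k : ℂ) ^ cycleCount σ k := by
  have := isProbabilityMeasure_ewensMeasure hθ N
  have hm : Measurable fun x : Equiv.Perm (Fin N) × (Fin N → Circle) =>
      complexChar s (wreathTrace F x) :=
    (continuous_complexChar s).measurable.comp (measurable_wreathTrace hF N)
  have hint : Integrable (fun x : Equiv.Perm (Fin N) × (Fin N → Circle) =>
      complexChar s (wreathTrace F x)) ((ewensMeasure θ N).prod (Measure.pi fun _ => ν)) :=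
    .of_bound hm.aestronglyMeasurable 1 (.of_forall fun x => (norm_complexChar _ _).le)
  have hc : (0 : ℝ) ≤ 1 / (ewensNorm θ N * (N ! : ℝ)) := by
    rw [ewensNorm_mul_factorial]
    exact one_div_nonneg.2 (Finset.sum_nonneg fun σ _ => (ewensWeight_pos hθ σ).le)
  change ∫ x, complexChar s (wreathTrace F x) ∂wreathMeasure θ ν N = _
  rw [wreathMeasure, integral_prod _ hint]
  simp only [integral_complexChar_wreathTrace hF ν s]
  rw [ewensMeasure, integral_finsetSum_measure fun σ _ =>
    Integrable.smul_measure Integrable.of_finite ENNReal.ofReal_ne_top]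
  have hden : ((ewensNorm θ N * (N ! : ℝ) : ℝ) : ℂ) =
      ∑ σ : Equiv.Perm (Fin N), ∏ k ∈ Finset.Icc 1 N, (θ k : ℂ) ^ cycleCount σ k := by
    rw [ewensNorm_mul_factorial]
    push_cast [ewensWeight]
    rfl
  rw [← hden, Finset.sum_div]
  refine Finset.sum_congr rfl fun σ _ => ?_
  rw [integral_smul_measure, integral_dirac, ENNReal.toReal_ofReal
    (mul_nonneg hc (ewensWeight_pos hθ σ).le), Complex.real_smul]
  simp only [mul_pow, Finset.prod_mul_distrib]
  push_cast [ewensWeight]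
  ring

/-- Numerator and denominator are both instances of the exponential formula, and `N !` cancels. -/
theorem charFunction_wreathTrace_eq {θ : ℕ → ℝ} (hθ : ∀ k, 1 ≤ k → 0 < θ k)
    {F : Circle → ℂ} (hF : Measurable F) (ν : Measure Circle) [IsProbabilityMeasure ν]
    (s : ℂ) (N : ℕ) :
    charFunction (wreathMeasure θ ν N) (fun x => wreathTrace F x) s =
      PowerSeries.coeff N (expSeries (gTrace θ F ν s)) /
        PowerSeries.coeff N (expSeries (gTheta θ)) := by
  have hN : (N ! : ℂ) ≠ 0 := by exact_mod_cast Nat.factorial_ne_zero N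
  have h1 : gTrace θ F ν s =
      PowerSeries.mk fun k : ℕ => ((θ k : ℂ) * cycleChar F ν k s) / (k : ℂ) := by
    ext k
    simp only [gTrace, PowerSeries.coeff_mk]
    push_cast
    ring
  have h2 : gTheta θ = PowerSeries.mk fun k : ℕ => (θ k : ℂ) / (k : ℂ) := by
    ext k
    simp [gTheta, PowerSeries.coeff_mk]
  rw [charFunction_wreathTrace_eq_sum hθ hF, h1, h2, ← sum_perm_prod_cycleCount,
    ← sum_perm_prod_cycleCount, div_div_div_cancel_right₀ hN]

/-! ### Singular expansion of the generating series -/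

theorem polyWeight_anti {α β : ℝ} (h : β ≤ α) (n : ℕ) : polyWeight α n ≤ polyWeight β n := by
  refine Real.rpow_le_rpow_of_exponent_le ?_ (by linarith)
  have : (0 : ℝ) ≤ n := Nat.cast_nonneg n
  linarith

theorem rpow_le_polyWeight {α : ℝ} (hα : 0 < α) {n : ℕ} (hn : 0 < n) :
    (n : ℝ) ^ (-1 - α) ≤ 2 ^ (1 + α) * polyWeight α n := by
  have h := polyWeight_le_of_le_two_mul hα (i := n - 1) (n := n) (by omega)
  have h1 : ((n - 1 : ℕ) : ℝ) + 1 = n := by exact_mod_cast Nat.sub_add_cancel hn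
  rwa [polyWeight, h1] at h

theorem polyWeight_le_rpow {α : ℝ} (hα : 0 < α) {n : ℕ} (hn : 0 < n) :
    polyWeight α n ≤ (n : ℝ) ^ (-1 - α) := by
  have : (0 : ℝ) < n := by exact_mod_cast hn
  exact Real.rpow_le_rpow_of_nonpos this (by linarith) (by linarith)

theorem exists_polyWeight_bound {α : ℝ} (hα : 0 < α) {f : ℕ → ℂ}
    (h : f =O[atTop] fun n : ℕ => (n : ℝ) ^ (-1 - α)) :
    ∃ C, ∀ n, ‖f n‖ ≤ C * polyWeight α n := by
  have h1 : (fun n : ℕ => (n : ℝ) ^ (-1 - α)) =O[atTop] polyWeight α := by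
    refine .of_bound (2 ^ (1 + α)) ?_
    filter_upwards [eventually_gt_atTop 0] with n hn
    rw [Real.norm_eq_abs, Real.norm_eq_abs, abs_of_pos (polyWeight_pos α n),
      abs_of_nonneg (by positivity)]
    exact rpow_le_polyWeight hα hn
  obtain ⟨C, -, hC⟩ := bound_of_isBigO_nat_atTop (h.trans h1)
  refine ⟨C, fun n => ?_⟩
  have := hC (polyWeight_pos α n).ne'
  rwa [Real.norm_eq_abs, abs_of_pos (polyWeight_pos α n)] at this

theorem isBigO_of_polyWeight_bound {α r C : ℝ} (hα : 0 < α) (hr : 0 < r) {f : ℕ → ℂ}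
    (h : ∀ n, ‖(r : ℂ) ^ n * f n‖ ≤ C * polyWeight α n) :
    f =O[atTop] fun n : ℕ => (r ^ n)⁻¹ * (n : ℝ) ^ (-1 - α) := by
  refine .of_bound C ?_
  have hC : 0 ≤ C := by
    have := (norm_nonneg _).trans (h 0)
    rwa [polyWeight_zero, mul_one] at this
  filter_upwards [eventually_gt_atTop 0] with n hn
  have hrn : 0 < r ^ n := pow_pos hr n
  have := h n
  rw [norm_mul, norm_pow, Complex.norm_real, Real.norm_eq_abs, abs_of_pos hr] at this
  rw [Real.norm_eq_abs, abs_of_nonneg (by positivity)]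
  calc ‖f n‖ = (r ^ n)⁻¹ * (r ^ n * ‖f n‖) := by field_simp
    _ ≤ (r ^ n)⁻¹ * (C * (n : ℝ) ^ (-1 - α)) := by
        refine mul_le_mul_of_nonneg_left (this.trans ?_) (by positivity)
        exact mul_le_mul_of_nonneg_left (polyWeight_le_rpow hα hn) hC
    _ = _ := by ring

theorem coeff_unique {r : ℝ} (hr : 0 < r) {a b : ℕ → ℂ} {H : ℂ → ℂ}
    (ha : ∀ t ∈ Metric.ball (0 : ℂ) r, HasSum (fun n => a n * t ^ n) (H t))
    (hb : ∀ t ∈ Metric.ball (0 : ℂ) r, HasSum (fun n => b n * t ^ n) (H t)) : a = b := by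
  have key : ∀ c : ℕ → ℂ, (∀ t ∈ Metric.ball (0 : ℂ) r, HasSum (fun n => c n * t ^ n) (H t)) →
      HasFPowerSeriesAt H (FormalMultilinearSeries.ofScalars ℂ c) 0 := by
    intro c hc
    rw [hasFPowerSeriesAt_iff]
    filter_upwards [Metric.ball_mem_nhds (0 : ℂ) hr] with t ht
    simpa [FormalMultilinearSeries.coeff_ofScalars, mul_comm] using hc t ht
  have h := (key a ha).eq_formalMultilinearSeries (key b hb)
  funext n
  have := congrArg (fun p => FormalMultilinearSeries.coeff p n) h
  simpa [FormalMultilinearSeries.coeff_ofScalars] using this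

theorem hasSum_log {r : ℝ} (hr : 0 < r) {t : ℂ} (ht : t ∈ Metric.ball (0 : ℂ) r) :
    HasSum (fun n : ℕ => (((r : ℂ) ^ n)⁻¹ / n) * t ^ n) (Complex.log (1 / (1 - t / (r : ℂ)))) := by
  have hr' : (r : ℂ) ≠ 0 := by exact_mod_cast hr.ne'
  have hz : ‖t / (r : ℂ)‖ < 1 := by
    rw [norm_div, Complex.norm_real, Real.norm_eq_abs, abs_of_pos hr, div_lt_one hr]
    simpa using ht
  have harg : (1 - t / (r : ℂ)).arg ≠ Real.pi := by
    intro h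
    have h1 := (Complex.arg_eq_pi_iff.1 h).1
    have h2 := (Complex.abs_re_le_norm (t / (r : ℂ))).trans_lt hz
    rw [Complex.sub_re, Complex.one_re] at h1
    have := (abs_lt.1 h2).2
    linarith
  rw [one_div, Complex.log_inv _ harg]
  convert! Complex.hasSum_taylorSeries_neg_log hz using 2 with n
  rw [div_pow]
  field_simp

/-- Uniqueness of Taylor coefficients turns the analytic definition into a coefficient statement,
with the singularity moved to `1`. The coefficient asymptotics use only this form. -/
theorem MemEF.exists_coeff {r ϑ γ : ℝ} (hr : 0 < r) (hγ : 0 < γ) {g : PowerSeries ℂ}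
    (hg : MemEF r ϑ γ g) :
    ∃ f : PowerSeries ℂ, PowerSeries.rescale (r : ℂ) g =
        PowerSeries.mk (fun n : ℕ => (ϑ / n : ℂ)) + f ∧
      ∃ C, ∀ n, ‖PowerSeries.coeff n f‖ ≤ C * polyWeight γ n := by
  obtain ⟨G, g₀, -, hG, hG₀, hO⟩ := hg
  have hr' (n : ℕ) : (r : ℂ) ^ n ≠ 0 := pow_ne_zero n (by exact_mod_cast hr.ne')
  have hcoeff : (fun n => PowerSeries.coeff n g) =
      fun n => PowerSeries.coeff n g₀ + ϑ * (((r : ℂ) ^ n)⁻¹ / n) := by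
    refine coeff_unique hr hG fun t ht => ?_
    have := (hG₀ t ht).add ((hasSum_log hr ht).mul_left (ϑ : ℂ))
    rw [sub_add_cancel] at this
    convert! this using 2 with n
    ring
  refine ⟨PowerSeries.rescale (r : ℂ) g₀, ?_, exists_polyWeight_bound hγ ?_⟩
  · ext n
    rw [map_add, PowerSeries.coeff_rescale, PowerSeries.coeff_rescale, PowerSeries.coeff_mk,
      congrFun hcoeff n]
    have := hr' n
    field_simp
    ring
  · simp only [PowerSeries.coeff_rescale]
    have h1 : (fun n : ℕ => (r : ℂ) ^ n) =O[atTop] fun n : ℕ => r ^ n := by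
      refine .of_bound 1 (.of_forall fun n => ?_)
      simp
    refine (h1.mul hO).congr_right fun n => ?_
    rw [mul_inv_cancel_left₀ (pow_ne_zero n hr.ne')]

/-- The series of `p` is dominated by a summable sequence on the whole disc, so it only modifies the
regular part `g₀`; the slower of the two decays survives. -/
theorem MemEF.add {r ϑ γ δ C : ℝ} (hr : 0 < r) (hδ : 0 < δ) {g p : PowerSeries ℂ}
    (hg : MemEF r ϑ γ g) (hp : ∀ n, ‖(r : ℂ) ^ n * PowerSeries.coeff n p‖ ≤ C * polyWeight δ n) :
    MemEF r ϑ (min γ δ) (g + p) := by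
  obtain ⟨G, g₀, hGd, hG, hG₀, hO⟩ := hg
  have hCW : Summable fun n => C * polyWeight δ n := (summable_polyWeight hδ).mul_left C
  have hle : ∀ n, ∀ t ∈ Metric.ball (0 : ℂ) r,
      ‖PowerSeries.coeff n p * t ^ n‖ ≤ C * polyWeight δ n := by
    intro n t ht
    refine le_trans ?_ (hp n)
    rw [norm_mul, norm_mul, mul_comm, norm_pow, norm_pow, Complex.norm_real, Real.norm_eq_abs,
      abs_of_pos hr]
    have : ‖t‖ ≤ r := by simpa using (Metric.mem_ball.1 ht).le
    gcongr
  have hPs : ∀ t ∈ Metric.ball (0 : ℂ) r, HasSum (fun n => PowerSeries.coeff n p * t ^ n)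
      (∑' n, PowerSeries.coeff n p * t ^ n) := fun t ht =>
    (Summable.of_norm_bounded hCW fun n => hle n t ht).hasSum
  have hPd : DifferentiableOn ℂ (fun t => ∑' n, PowerSeries.coeff n p * t ^ n)
      (Metric.ball (0 : ℂ) r) :=
    Complex.differentiableOn_tsum_of_summable_norm hCW (fun n => by fun_prop) Metric.isOpen_ball hle
  refine ⟨_, g₀ + p, hGd.add hPd, fun t ht => ?_, fun t ht => ?_, ?_⟩
  · simpa [add_mul] using (hG t ht).add (hPs t ht)
  · convert! (hG₀ t ht).add (hPs t ht) using 1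
    · funext n
      simp [add_mul]
    · simp only [Pi.add_apply]
      ring
  · have h1 := isBigO_of_polyWeight_bound hδ hr hp
    have hm : ∀ {β : ℝ}, min γ δ ≤ β →
        (fun n : ℕ => (r ^ n)⁻¹ * (n : ℝ) ^ (-1 - β)) =O[atTop]
          fun n : ℕ => (r ^ n)⁻¹ * (n : ℝ) ^ (-1 - min γ δ) := by
      intro β hβ
      refine (isBigO_refl _ _).mul (.of_bound 1 ?_)
      filter_upwards [eventually_ge_atTop 1] with n hn
      have hn' : (1 : ℝ) ≤ n := by exact_mod_cast hn
      rw [one_mul, Real.norm_eq_abs, Real.norm_eq_abs, abs_of_nonneg (by positivity),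
        abs_of_nonneg (by positivity)]
      exact Real.rpow_le_rpow_of_exponent_le hn' (by linarith)
    simp only [map_add]
    exact (hO.trans (hm (min_le_left _ _))).add (h1.trans (hm (min_le_right _ _)))

/-- Transfer: the coefficients of `exp(f(t)) (1 - t) ^ (-ϑ)`. -/
theorem coeff_expSeries_isBigO {ϑ α C : ℝ} (hϑ : 0 < ϑ) (hα : 0 < α) (hα' : α ≤ 1)
    {f : PowerSeries ℂ} (h0 : PowerSeries.constantCoeff f = 0)
    (hf : ∀ n, ‖PowerSeries.coeff n f‖ ≤ C * polyWeight α n) :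
    (fun N : ℕ => PowerSeries.coeff N
        (expSeries (PowerSeries.mk (fun n : ℕ => (ϑ / n : ℂ)) + f)) / (binomCoeff ϑ N : ℂ) -
        Complex.exp (∑' n, PowerSeries.coeff n f)) =O[atTop]
      fun N : ℕ => (N : ℝ) ^ (-α) * Real.log N := by
  obtain ⟨⟨B, hB⟩, hsum⟩ := expSeries_polyWeight hα h0 hf
  have h1 : PowerSeries.constantCoeff (PowerSeries.mk (fun n : ℕ => (ϑ / n : ℂ))) = 0 := by
    simp [← PowerSeries.coeff_zero_eq_constantCoeff_apply]
  have h := conv_binomCoeff_isBigO hϑ hα hα' hB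
  rw [hsum.tsum_eq] at h
  refine h.congr_left fun N => ?_
  rw [expSeries_add h1 h0, ← mk_binomCoeff_eq_expSeries, mul_comm (PowerSeries.mk _),
    PowerSeries.coeff_mul]
  simp only [PowerSeries.coeff_mk]

theorem tendsto_rpow_neg_mul_log {α : ℝ} (hα : 0 < α) :
    Tendsto (fun N : ℕ => (N : ℝ) ^ (-α) * Real.log N) atTop (𝓝 0) := by
  have h := (isLittleO_log_rpow_atTop hα).tendsto_div_nhds_zero
  refine (h.comp tendsto_natCast_atTop_atTop).congr fun N => ?_
  rw [Function.comp_apply, Real.rpow_neg (Nat.cast_nonneg N)]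
  ring

theorem div_sub_div_isBigO {u v : ℕ → ℂ} {a b : ℂ} {ε : ℕ → ℝ} (hb : b ≠ 0)
    (hε : Tendsto ε atTop (𝓝 0)) (hu : (fun n => u n - a) =O[atTop] ε)
    (hv : (fun n => v n - b) =O[atTop] ε) :
    (fun n => u n / v n - a / b) =O[atTop] ε := by
  have hvt : Tendsto v atTop (𝓝 b) := by
    have := (hv.trans_tendsto hε).add_const b
    simpa using this
  have hinv : (fun n => (v n)⁻¹) =O[atTop] fun _ => (1 : ℝ) := (hvt.inv₀ hb).isBigO_one ℝ
  have h1 := ((hu.sub (hv.const_mul_left (a / b)))).mul hinv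
  simp only [mul_one] at h1
  refine h1.congr' ?_ (.of_eq rfl)
  filter_upwards [hvt.eventually_ne hb] with n hn
  field_simp
  ring

/-- The ratio of the coefficients of the exponentials of two generating series. -/
theorem coeff_expSeries_ratio_isBigO {r ϑ γ δ C : ℝ} (hr : 0 < r) (hϑ : 0 < ϑ) (hγ : 0 < γ)
    (hγ' : γ ≤ 1) (hδ : 0 < δ) {g p : PowerSeries ℂ} (hg : MemEF r ϑ γ g)
    (hg0 : PowerSeries.constantCoeff g = 0) (hp0 : PowerSeries.constantCoeff p = 0)
    (hp : ∀ n, ‖(r : ℂ) ^ n * PowerSeries.coeff n p‖ ≤ C * polyWeight δ n) :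
    (fun N : ℕ => PowerSeries.coeff N (expSeries (g + p)) / PowerSeries.coeff N (expSeries g) -
        Complex.exp (∑' n, (r : ℂ) ^ n * PowerSeries.coeff n p)) =O[atTop]
      fun N : ℕ => (N : ℝ) ^ (-(min γ δ)) * Real.log N := by
  obtain ⟨f, hf, B, hB⟩ := hg.exists_coeff hr hγ
  have hα : 0 < min γ δ := lt_min hγ hδ
  have hα' : min γ δ ≤ 1 := (min_le_left _ _).trans hγ'
  have hrescale0 : ∀ q : PowerSeries ℂ, PowerSeries.constantCoeff q = 0 →
      PowerSeries.constantCoeff (PowerSeries.rescale (r : ℂ) q) = 0 := by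
    intro q hq
    rw [← PowerSeries.coeff_zero_eq_constantCoeff_apply, PowerSeries.coeff_rescale]
    simp [hq]
  have hf0 : PowerSeries.constantCoeff f = 0 := by
    have := hrescale0 g hg0
    have h1 : PowerSeries.constantCoeff (PowerSeries.mk (fun n : ℕ => (ϑ / n : ℂ))) = 0 := by
      simp [← PowerSeries.coeff_zero_eq_constantCoeff_apply]
    rwa [hf, map_add, h1, zero_add] at this
  have hB0 : 0 ≤ B := by
    have := (norm_nonneg _).trans (hB 0)
    rwa [polyWeight_zero, mul_one] at this
  have hC0 : 0 ≤ C := by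
    have := (norm_nonneg _).trans (hp 0)
    rwa [polyWeight_zero, mul_one] at this
  have hfW : ∀ n, ‖PowerSeries.coeff n f‖ ≤ B * polyWeight (min γ δ) n := fun n =>
    (hB n).trans (mul_le_mul_of_nonneg_left (polyWeight_anti (min_le_left _ _) n) hB0)
  have hpW : ∀ n, ‖PowerSeries.coeff n (PowerSeries.rescale (r : ℂ) p)‖ ≤
      C * polyWeight (min γ δ) n := fun n => by
    rw [PowerSeries.coeff_rescale]
    exact (hp n).trans (mul_le_mul_of_nonneg_left (polyWeight_anti (min_le_right _ _) n) hC0)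
  have hfpW : ∀ n, ‖PowerSeries.coeff n (f + PowerSeries.rescale (r : ℂ) p)‖ ≤
      (B + C) * polyWeight (min γ δ) n := fun n => by
    rw [map_add, add_mul]
    exact (norm_add_le _ _).trans (add_le_add (hfW n) (hpW n))
  have h1 := coeff_expSeries_isBigO hϑ hα hα' hf0 hfW
  have h2 := coeff_expSeries_isBigO hϑ hα hα' (f := f + PowerSeries.rescale (r : ℂ) p)
    (by rw [map_add, hf0, hrescale0 p hp0, add_zero]) hfpW
  -- Both coefficient sequences are divided by the same `binomCoeff ϑ N`, which cancels in the ratio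
  -- together with `r ^ N`.
  have h3 := div_sub_div_isBigO (Complex.exp_ne_zero _) (tendsto_rpow_neg_mul_log hα) h2 h1
  have hsW := summable_polyWeight hα
  have hfs : Summable fun n => PowerSeries.coeff n f := .of_norm_bounded (hsW.mul_left B) hfW
  have hps : Summable fun n => PowerSeries.coeff n (PowerSeries.rescale (r : ℂ) p) :=
    .of_norm_bounded (hsW.mul_left C) hpW
  refine h3.congr_left fun N => ?_
  have hrN : (r : ℂ) ^ N ≠ 0 := pow_ne_zero N (by exact_mod_cast hr.ne')
  have hcN : (binomCoeff ϑ N : ℂ) ≠ 0 := by exact_mod_cast (binomCoeff_pos hϑ N).ne'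
  congr 1
  · rw [← add_assoc, ← hf, ← map_add, expSeries_rescale hg0,
      expSeries_rescale (by rw [map_add, hg0, hp0, add_zero]), PowerSeries.coeff_rescale,
      PowerSeries.coeff_rescale, div_div_div_cancel_right₀ hcN, mul_div_mul_left _ _ hrN]
  · simp only [map_add]
    rw [hfs.tsum_add hps, Complex.exp_add, mul_div_cancel_left₀ _ (Complex.exp_ne_zero _)]
    simp only [PowerSeries.coeff_rescale]

/-! ### The perturbation of the generating series -/

/-- The difference of `g_{tr(F)}` and `g_Θ`. -/
def gDiff (θ : ℕ → ℝ) (F : Circle → ℂ) (ν : Measure Circle) (s : ℂ) : PowerSeries ℂ :=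
  PowerSeries.mk fun k => ((θ k / k : ℝ) : ℂ) * (cycleChar F ν k s - 1)

theorem gTrace_eq_add (θ : ℕ → ℝ) (F : Circle → ℂ) (ν : Measure Circle) (s : ℂ) :
    gTrace θ F ν s = gTheta θ + gDiff θ F ν s := by
  ext k
  simp only [gTrace, gTheta, gDiff, map_add, PowerSeries.coeff_mk]
  ring

/-- Integrates `|exp(ix) - 1| ≤ |x|`. With extended values, integrability of the root average need
not be known. -/
theorem enorm_cycleChar_sub_one_le {F : Circle → ℂ} (hF : Measurable F) (ν : Measure Circle)
    [IsProbabilityMeasure ν] (k : ℕ) (s : ℂ) :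
    ‖cycleChar F ν k s - 1‖ₑ ≤ ‖s‖ₑ * (k * ∫⁻ y, ‖rootAverage F k y‖ₑ ∂cycleLaw ν k) := by
  have hm : Measurable fun y => complexChar s ((k : ℂ) * rootAverage F k y) :=
    (continuous_complexChar s).measurable.comp (measurable_mul_rootAverage hF k)
  have hint : Integrable (fun y => complexChar s ((k : ℂ) * rootAverage F k y)) (cycleLaw ν k) :=
    .of_bound hm.aestronglyMeasurable 1 (.of_forall fun y => (norm_complexChar _ _).le)
  have h1 : cycleChar F ν k s - 1 =
      ∫ y, (complexChar s ((k : ℂ) * rootAverage F k y) - 1) ∂cycleLaw ν k := by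
    rw [integral_sub hint (integrable_const _)]
    simp
    rfl
  rw [h1]
  refine (enorm_integral_le_lintegral_enorm _).trans ?_
  rw [← mul_assoc, ← lintegral_const_mul' _ _ (ENNReal.mul_ne_top enorm_ne_top (ENNReal.natCast_ne_top k))]
  refine lintegral_mono fun y => ?_
  have h2 := norm_complexChar_sub_one_le s ((k : ℂ) * rootAverage F k y)
  rw [norm_mul, Complex.norm_natCast, ← mul_assoc] at h2
  have h3 := ENNReal.ofReal_le_ofReal h2
  rw [ENNReal.ofReal_mul (by positivity), ENNReal.ofReal_mul (norm_nonneg _), ofReal_norm, ofReal_norm,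
    ofReal_norm, ENNReal.ofReal_natCast] at h3
  exact h3

/-- The expansion gives `θ_k r ^ k = ϑ + O(k ^ (-γ))`, which is bounded. -/
theorem gTheta_isBigO {θ : ℕ → ℝ} {r ϑ γ : ℝ} (hr : 0 < r) (hγ : 0 < γ)
    (hg : MemEF r ϑ γ (gTheta θ)) :
    (fun k : ℕ => θ k * r ^ k / k) =O[atTop] fun k : ℕ => ((k : ℝ))⁻¹ := by
  obtain ⟨f, hf, C, hC⟩ := hg.exists_coeff hr hγ
  have hC0 : 0 ≤ C := by
    have := (norm_nonneg _).trans (hC 0)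
    rwa [polyWeight_zero, mul_one] at this
  refine .of_bound (|ϑ| + C) ?_
  filter_upwards [eventually_ge_atTop 1] with k hk
  have hk1 : (1 : ℝ) ≤ k := by exact_mod_cast hk
  have h := congrArg (PowerSeries.coeff k) hf
  rw [PowerSeries.coeff_rescale, map_add, gTheta, PowerSeries.coeff_mk, PowerSeries.coeff_mk] at h
  have h1 : ‖θ k * r ^ k / k‖ = ‖(ϑ / k : ℂ) + PowerSeries.coeff k f‖ := by
    rw [← h, ← Complex.norm_real]
    congr 1
    push_cast
    ring
  have h2 : polyWeight γ k ≤ (k : ℝ)⁻¹ := by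
    refine (polyWeight_le_rpow hγ hk).trans ?_
    rw [← Real.rpow_neg_one]
    exact Real.rpow_le_rpow_of_exponent_le hk1 (by linarith)
  rw [h1, Real.norm_of_nonneg (by positivity : (0 : ℝ) ≤ (k : ℝ)⁻¹)]
  refine (norm_add_le _ _).trans ?_
  rw [norm_div, Complex.norm_real, Complex.norm_natCast, Real.norm_eq_abs, add_mul, div_eq_mul_inv]
  gcongr
  exact (hC k).trans (by gcongr)

theorem cycleChar_sub_one_isBigO {F : Circle → ℂ} (hF : Measurable F) (ν : Measure Circle)
    [IsProbabilityMeasure ν] {δ : ℝ}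
    (hΔ : ∃ C : ℝ, ∀ᶠ k : ℕ in atTop, ∫⁻ y, ‖rootAverage F k y‖ₑ ∂cycleLaw ν k
      ≤ ENNReal.ofReal (C * (k : ℝ) ^ (-1 - δ))) (s : ℂ) :
    (fun k : ℕ => cycleChar F ν k s - 1) =O[atTop] fun k : ℕ => (k : ℝ) ^ (-δ) := by
  obtain ⟨C, hC⟩ := hΔ
  refine .of_bound (‖s‖ * |C|) ?_
  filter_upwards [hC, eventually_gt_atTop 0] with k hk hk0
  have hk0' : (0 : ℝ) < k := by exact_mod_cast hk0
  have hk1 : C * (k : ℝ) ^ (-1 - δ) ≤ |C| * (k : ℝ) ^ (-1 - δ) :=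
    mul_le_mul_of_nonneg_right (le_abs_self C) (by positivity)
  have h1 := (enorm_cycleChar_sub_one_le hF ν k s).trans
    (mul_le_mul_right (mul_le_mul_right (hk.trans (ENNReal.ofReal_le_ofReal hk1)) _) _)
  rw [← ofReal_norm, ← ofReal_norm, ← ENNReal.ofReal_natCast k, ← ENNReal.ofReal_mul (by positivity),
    ← ENNReal.ofReal_mul (by positivity), ENNReal.ofReal_le_ofReal_iff (by positivity)] at h1
  rw [Real.norm_of_nonneg (by positivity : (0 : ℝ) ≤ (k : ℝ) ^ (-δ))]
  refine h1.trans_eq ?_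
  have h2 : (k : ℝ) ^ (-δ) = k * (k : ℝ) ^ (-1 - δ) := by
    rw [sub_eq_add_neg, Real.rpow_add hk0', Real.rpow_neg_one, mul_inv_cancel_left₀ hk0'.ne']
  rw [h2]
  ring

theorem inv_mul_rpow_neg_eventuallyEq (δ : ℝ) :
    (fun k : ℕ => (k : ℝ)⁻¹ * (k : ℝ) ^ (-δ)) =ᶠ[atTop] fun k : ℕ => (k : ℝ) ^ (-1 - δ) := by
  filter_upwards [eventually_gt_atTop 0] with k hk
  have hk' : (0 : ℝ) < k := by exact_mod_cast hk
  rw [sub_eq_add_neg, Real.rpow_add hk', Real.rpow_neg_one]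

theorem exists_gDiff_bound {θ : ℕ → ℝ} {F : Circle → ℂ} (hF : Measurable F) (ν : Measure Circle)
    [IsProbabilityMeasure ν] {r ϑ γ δ : ℝ} (hr : 0 < r) (hγ : 0 < γ) (hδ : 0 < δ)
    (hΔ : ∃ C : ℝ, ∀ᶠ k : ℕ in atTop, ∫⁻ y, ‖rootAverage F k y‖ₑ ∂cycleLaw ν k
      ≤ ENNReal.ofReal (C * (k : ℝ) ^ (-1 - δ)))
    (hg : MemEF r ϑ γ (gTheta θ)) (s : ℂ) :
    ∃ C, ∀ n, ‖(r : ℂ) ^ n * PowerSeries.coeff n (gDiff θ F ν s)‖ ≤ C * polyWeight δ n := by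
  refine exists_polyWeight_bound hδ ?_
  have h1 : (fun k : ℕ => ((θ k * r ^ k / k : ℝ) : ℂ)) =O[atTop] fun k : ℕ => (k : ℝ)⁻¹ :=
    (gTheta_isBigO hr hγ hg).norm_left.congr_left (fun k => (Complex.norm_real _).symm) |>.of_norm_left
  have h2 := (h1.mul (cycleChar_sub_one_isBigO hF ν hΔ s)).trans_eventuallyEq
    (inv_mul_rpow_neg_eventuallyEq δ)
  refine h2.congr_left fun k => ?_
  rw [gDiff, PowerSeries.coeff_mk]
  push_cast
  ring

theorem constantCoeff_gTheta (θ : ℕ → ℝ) : PowerSeries.constantCoeff (gTheta θ) = 0 := by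
  simp [← PowerSeries.coeff_zero_eq_constantCoeff_apply, gTheta]

theorem constantCoeff_gDiff (θ : ℕ → ℝ) (F : Circle → ℂ) (ν : Measure Circle) (s : ℂ) :
    PowerSeries.constantCoeff (gDiff θ F ν s) = 0 := by
  simp [← PowerSeries.coeff_zero_eq_constantCoeff_apply, gDiff]

/-! ### The compound Poisson limit -/

theorem lintegral_natCast_poissonMeasure (a : NNReal) :
    ∫⁻ n, (n : ENNReal) ∂poissonMeasure a = a := by
  have h0 : HasSum (fun n : ℕ => ((n + 1 : ℕ) : ℝ) *
      (Real.exp (-a) * (a : ℝ) ^ (n + 1) / ((n + 1)! : ℝ))) a := by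
    have h := (hasSum_one_poissonMeasure a).mul_left (a : ℝ)
    rw [mul_one] at h
    convert! h using 2 with n
    rw [Nat.factorial_succ]
    push_cast
    have : ((n : ℝ) + 1) ≠ 0 := by positivity
    field_simp
    ring
  have h1 : HasSum (fun n : ℕ => (n : ℝ) * (Real.exp (-a) * (a : ℝ) ^ n / (n ! : ℝ))) a := by
    rw [← hasSum_nat_add_iff' 1]
    simpa using h0
  rw [lintegral_countable']
  have h2 (n : ℕ) : (n : ENNReal) * poissonMeasure a {n} =
      ENNReal.ofReal ((n : ℝ) * (Real.exp (-a) * (a : ℝ) ^ n / (n ! : ℝ))) := by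
    rw [poissonMeasure_singleton, ENNReal.ofReal_mul (Nat.cast_nonneg n), ENNReal.ofReal_natCast]
  simp only [h2]
  rw [← ENNReal.ofReal_tsum_of_nonneg (fun n => by positivity) h1.summable, h1.tsum_eq,
    ENNReal.ofReal_coe_nnreal]

theorem integral_pow_poissonMeasure (a : NNReal) (c : ℂ) :
    ∫ n, c ^ n ∂poissonMeasure a = Complex.exp ((a : ℝ) * (c - 1)) := by
  rw [integral_poissonMeasure]
  have h := (NormedSpace.expSeries_div_hasSum_exp ((a : ℂ) * c)).mul_left (Complex.exp (-(a : ℝ)))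
  rw [← Complex.exp_eq_exp_ℂ, ← Complex.exp_add] at h
  have h2 : (fun n : ℕ => (Real.exp (-(a : ℝ)) * (a : ℝ) ^ n / (n ! : ℝ)) • c ^ n) =
      fun n : ℕ => Complex.exp (-(a : ℝ)) * (((a : ℂ) * c) ^ n / (n ! : ℂ)) := by
    funext n
    rw [Complex.real_smul, mul_pow]
    push_cast
    ring
  rw [h2, h.tsum_eq]
  congr 1
  ring

section Limit

variable {θ : ℕ → ℝ} {r : ℝ} {ν : Measure Circle} {Ω : Type*} [MeasurableSpace Ω] {Pr : Measure Ω}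
  {P : ℕ → Ω → ℕ} {Z : ℕ → ℕ → Ω → Circle}

theorem IsLimitData.indepFun_apply (h : IsLimitData θ r ν Pr P Z) {k : ℕ} (hk : 1 ≤ k) (m : ℕ) :
    IndepFun (P k) (Z k m) Pr := by
  have := h.indep_P_Z.comp (measurable_pi_apply (⟨k, hk⟩ : {k : ℕ // 1 ≤ k}))
    (measurable_pi_apply ((⟨k, hk⟩, m) : {k : ℕ // 1 ≤ k} × ℕ))
  exact this

/-- Wald's identity: the random sum is `∑ 1{m < P} f(Z_m)`, independence and Tonelli apply to each
term, and `∑ Pr(P > m)` is the Poisson mean. -/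
theorem IsLimitData.lintegral_block (h : IsLimitData θ r ν Pr P Z) {k : ℕ} (hk : 1 ≤ k)
    {f : Circle → ENNReal} (hf : Measurable f) :
    ∫⁻ ω, ∑ m ∈ Finset.range (P k ω), f (Z k m ω) ∂Pr =
      ENNReal.ofReal (θ k * r ^ k / k) * ∫⁻ y, f y ∂cycleLaw ν k := by
  have hP := h.law_P k hk
  have hind (m : ℕ) : Measurable fun n : ℕ => if m < n then (1 : ENNReal) else 0 := .of_discrete
  have h1 (ω : Ω) : ∑ m ∈ Finset.range (P k ω), f (Z k m ω) =
      ∑' m, (if m < P k ω then 1 else 0) * f (Z k m ω) := by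
    rw [tsum_eq_sum (s := Finset.range (P k ω))]
    · refine Finset.sum_congr rfl fun m hm => ?_
      rw [if_pos (Finset.mem_range.1 hm), one_mul]
    · intro m hm
      rw [if_neg (by simpa using hm), zero_mul]
  have h2 (m : ℕ) : ∫⁻ ω, (if m < P k ω then 1 else 0) * f (Z k m ω) ∂Pr =
      (∫⁻ n, (if m < n then 1 else 0) ∂poissonMeasure (θ k * r ^ k / k).toNNReal) *
        ∫⁻ y, f y ∂cycleLaw ν k := by
    rw [← hP.lintegral_comp (hind m).aemeasurable,
      ← (h.law_Z k m hk).lintegral_comp hf.aemeasurable]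
    exact lintegral_mul_eq_lintegral_mul_lintegral_of_indepFun''
      ((hind m).comp_aemeasurable hP.aemeasurable)
      (hf.comp_aemeasurable (h.law_Z k m hk).aemeasurable)
      ((h.indepFun_apply hk m).comp (hind m) hf)
  have h4 (m : ℕ) : AEMeasurable (fun ω => (if m < P k ω then 1 else 0) * f (Z k m ω)) Pr :=
    ((hind m).comp_aemeasurable hP.aemeasurable).mul
      (hf.comp_aemeasurable (h.law_Z k m hk).aemeasurable)
  simp only [h1]
  rw [lintegral_tsum h4]
  simp only [h2]
  rw [ENNReal.tsum_mul_right, ← lintegral_tsum fun m => (hind m).aemeasurable]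
  have h3 (n : ℕ) : ∑' m : ℕ, (if m < n then (1 : ENNReal) else 0) = n := by
    rw [tsum_eq_sum (s := Finset.range n)]
    · rw [Finset.sum_congr rfl fun m hm => if_pos (Finset.mem_range.1 hm)]
      simp
    · intro m hm
      exact if_neg (by simpa using hm)
  simp only [h3]
  rw [lintegral_natCast_poissonMeasure]
  rfl

theorem aemeasurable_sum_range {M : Type*} [AddCommMonoid M] [MeasurableSpace M]
    [MeasurableAdd₂ M] {f : Circle → M} (hf : Measurable f)
    {Q : Ω → ℕ} (hQ : AEMeasurable Q Pr) {W : ℕ → Ω → Circle} (hW : ∀ m, AEMeasurable (W m) Pr) :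
    AEMeasurable (fun ω => ∑ m ∈ Finset.range (Q ω), f (W m ω)) Pr := by
  have hm : Measurable fun a : (ℕ → Circle) × ℕ => ∑ m ∈ Finset.range a.2, f (a.1 m) := by
    refine measurable_from_prod_countable_left fun n => ?_
    exact Finset.measurable_sum (Finset.range n) fun m _ => hf.comp (measurable_pi_apply m)
  exact hm.comp_aemeasurable ((aemeasurable_pi_iff.2 hW).prodMk hQ)

theorem ae_tsum_ne_top {e : ℕ → Ω → ENNReal} (he : ∀ k, AEMeasurable (e k) Pr) {b : ℕ → ℝ}
    (hb : Summable b) (hle : ∀ k, ∫⁻ ω, e k ω ∂Pr ≤ ENNReal.ofReal (b k)) :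
    ∀ᵐ ω ∂Pr, ∑' k, e k ω ≠ ⊤ := by
  have hfin : ∫⁻ ω, ∑' k, e k ω ∂Pr ≠ ⊤ := by
    rw [lintegral_tsum he]
    exact ne_top_of_le_ne_top hb.abs.tsum_ofReal_ne_top (ENNReal.tsum_le_tsum fun k =>
      (hle k).trans (ENNReal.ofReal_le_ofReal (le_abs_self _)))
  filter_upwards [ae_lt_top' (AEMeasurable.tsum he) hfin] with ω hω using hω.ne

theorem IsLimitData.ae_summable (h : IsLimitData θ r ν Pr P Z)
    {f : ℕ → Circle → ℂ} (hf : ∀ k, Measurable (f k)) {b : ℕ → ℝ} (hb : Summable b)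
    (hle : ∀ᶠ k : ℕ in atTop, ENNReal.ofReal (θ k * r ^ k / k) * ∫⁻ y, ‖f k y‖ₑ ∂cycleLaw ν k ≤
      ENNReal.ofReal (b k)) :
    ∀ᵐ ω ∂Pr, Summable fun k : ℕ => ∑ m ∈ Finset.range (P k ω), ‖f k (Z k m ω)‖ := by
  obtain ⟨K, hK⟩ := eventually_atTop.1 hle
  -- Shifting by `K + 1` discards the blocks without an available bound and also `k = 0`, whose law
  -- is unspecified. Finitely many blocks do not affect summability.
  have hK1 (k : ℕ) : 1 ≤ k + (K + 1) := by omega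
  let e : ℕ → Ω → ENNReal := fun k ω => ∑ m ∈ Finset.range (P k ω), ‖f k (Z k m ω)‖ₑ
  have hm (k : ℕ) (hk : 1 ≤ k) : AEMeasurable (e k) Pr :=
    aemeasurable_sum_range (hf _).enorm (h.law_P _ hk).aemeasurable
      fun m => (h.law_Z _ m hk).aemeasurable
  have hle' (k : ℕ) : ∫⁻ ω, e (k + (K + 1)) ω ∂Pr ≤ ENNReal.ofReal (b (k + (K + 1))) := by
    refine (h.lintegral_block (hK1 k) (hf _).enorm).trans_le (hK _ (by omega))
  filter_upwards [ae_tsum_ne_top (fun k => hm _ (hK1 k)) ((summable_nat_add_iff (K + 1)).2 hb) hle']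
    with ω hω
  rw [← summable_nat_add_iff (K + 1)]
  refine (ENNReal.summable_toReal hω).congr fun k => ?_
  rw [ENNReal.toReal_sum fun m _ => enorm_ne_top]
  simp

theorem IsLimitData.integral_prod_Z (h : IsLimitData θ r ν Pr P Z)
    {u : ℕ → Circle → ℂ} (hu : ∀ k, Measurable (u k)) (T : Finset {k : ℕ // 1 ≤ k})
    (p : {k : ℕ // 1 ≤ k} → ℕ) :
    ∫ ω, ∏ k ∈ T, ∏ m ∈ Finset.range (p k), u k (Z k m ω) ∂Pr =
      ∏ k ∈ T, (∫ y, u k y ∂cycleLaw ν k) ^ p k := by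
  let S : Finset (Σ _ : {k : ℕ // 1 ≤ k}, ℕ) := T.sigma fun k => Finset.range (p k)
  have hZ (a : S) : HasLaw (Z a.1.1 a.1.2) (cycleLaw ν a.1.1) Pr := h.law_Z _ _ a.1.1.2
  have hinj : Function.Injective fun a : S => ((a.1.1, a.1.2) : {k : ℕ // 1 ≤ k} × ℕ) := by
    rintro ⟨⟨a, b⟩, h₁⟩ ⟨⟨c, d⟩, h₂⟩ hac
    simp only [Prod.mk.injEq] at hac
    obtain ⟨rfl, rfl⟩ := hac
    rfl
  have hind := (h.indep_Z.precomp hinj).integral_fun_prod_comp (f := fun a : S => u a.1.1)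
    (fun a => (hZ a).aemeasurable) fun a => (hu _).aestronglyMeasurable
  have h1 (ω : Ω) : ∏ k ∈ T, ∏ m ∈ Finset.range (p k), u k (Z k m ω) =
      ∏ a : S, u a.1.1 (Z a.1.1 a.1.2 ω) := by
    rw [Finset.prod_coe_sort S fun a => u a.1 (Z a.1 a.2 ω), Finset.prod_sigma]
  have h2 : ∏ k ∈ T, (∫ y, u k y ∂cycleLaw ν k) ^ p k =
      ∏ a : S, ∫ y, u a.1.1 y ∂cycleLaw ν a.1.1 := by
    rw [Finset.prod_coe_sort S fun a => ∫ y, u a.1 y ∂cycleLaw ν a.1, Finset.prod_sigma]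
    simp
  simp only [h1]
  rw [h2]
  refine hind.trans (Finset.prod_congr rfl fun a _ => ?_)
  exact (hZ a).integral_comp (hu _).aestronglyMeasurable

theorem IsLimitData.integral_prod_P [IsProbabilityMeasure Pr] (h : IsLimitData θ r ν Pr P Z)
    (T : Finset {k : ℕ // 1 ≤ k}) (c : ℕ → ℂ) :
    ∫ ω, ∏ k ∈ T, c k ^ P k ω ∂Pr =
      ∏ k ∈ T, Complex.exp (((θ k * r ^ (k : ℕ) / (k : ℕ)).toNNReal : ℝ) * (c k - 1)) := by
  have hP (a : T) : HasLaw (P a.1) (poissonMeasure (θ a.1 * r ^ (a.1 : ℕ) / (a.1 : ℕ)).toNNReal) Pr :=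
    h.law_P _ a.1.2
  have hind := (h.indep_P.precomp (g := fun a : T => a.1)
    Subtype.val_injective).integral_fun_prod_comp (f := fun a : T => fun n : ℕ => c a.1 ^ n)
    (fun a => (hP a).aemeasurable) fun a => .of_discrete
  have h1 (ω : Ω) : ∏ k ∈ T, c k ^ P k ω = ∏ a : T, c a.1 ^ P a.1 ω := by
    rw [Finset.prod_coe_sort T fun a => c a ^ P a ω]
  rw [← Finset.prod_coe_sort T fun k =>
    Complex.exp (((θ k * r ^ (k : ℕ) / (k : ℕ)).toNNReal : ℝ) * (c k - 1))]
  simp only [h1]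
  refine hind.trans (Finset.prod_congr rfl fun a _ => ?_)
  rw [← integral_pow_poissonMeasure]
  exact (hP a).integral_comp (f := fun n : ℕ => c a.1 ^ n) .of_discrete

/-- Conditioning on the Poisson variables, via the product form of the joint law: for fixed counts
the inner integral is a product of powers, to which the Poisson generating function applies. -/
theorem IsLimitData.integral_prod_blocks [IsProbabilityMeasure Pr]
    (h : IsLimitData θ r ν Pr P Z) {u : ℕ → Circle → ℂ} (hu : ∀ k, Measurable (u k))
    (hu1 : ∀ k y, ‖u k y‖ ≤ 1) (T : Finset {k : ℕ // 1 ≤ k}) :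
    ∫ ω, ∏ k ∈ T, ∏ m ∈ Finset.range (P k ω), u k (Z k m ω) ∂Pr =
      ∏ k ∈ T, Complex.exp (((θ k * r ^ (k : ℕ) / (k : ℕ)).toNNReal : ℝ) *
        ((∫ y, u k y ∂cycleLaw ν k) - 1)) := by
  set PP : Ω → {k : ℕ // 1 ≤ k} → ℕ := fun ω k => P k ω with hPP
  set ZZ : Ω → {k : ℕ // 1 ≤ k} × ℕ → Circle := fun ω a => Z a.1 a.2 ω with hZZ
  have hPm : AEMeasurable PP Pr := aemeasurable_pi_iff.2 fun k => (h.law_P k k.2).aemeasurable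
  have hZm : AEMeasurable ZZ Pr :=
    aemeasurable_pi_iff.2 fun a => (h.law_Z a.1 a.2 a.1.2).aemeasurable
  set H : ({k : ℕ // 1 ≤ k} → ℕ) × ({k : ℕ // 1 ≤ k} × ℕ → Circle) → ℂ :=
    fun a => ∏ k ∈ T, ∏ m ∈ Finset.range (a.1 k), u k (a.2 (k, m)) with hH
  have hHm : Measurable H := by
    refine Finset.measurable_prod _ fun k _ => ?_
    have h1 : Measurable fun b : ({k : ℕ // 1 ≤ k} × ℕ → Circle) × ℕ =>
        ∏ m ∈ Finset.range b.2, u k (b.1 (k, m)) := by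
      refine measurable_from_prod_countable_left fun n => ?_
      exact Finset.measurable_prod (Finset.range n) fun m _ => (hu k).comp (measurable_pi_apply _)
    exact h1.comp (measurable_snd.prodMk ((measurable_pi_apply k).comp measurable_fst))
  have hH1 : ∀ a, ‖H a‖ ≤ 1 := by
    intro a
    simp only [hH, norm_prod]
    exact Finset.prod_le_one (fun _ _ => Finset.prod_nonneg fun _ _ => norm_nonneg _) fun k _ =>
      Finset.prod_le_one (fun _ _ => norm_nonneg _) fun m _ => hu1 _ _
  have : IsProbabilityMeasure (Pr.map PP) := Measure.isProbabilityMeasure_map hPm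
  have : IsProbabilityMeasure (Pr.map ZZ) := Measure.isProbabilityMeasure_map hZm
  have hprod := h.indep_P_Z.map_prod_eq_prod_map_map hPm hZm
  have hint : Integrable H ((Pr.map PP).prod (Pr.map ZZ)) :=
    .of_bound hHm.aestronglyMeasurable 1 (.of_forall hH1)
  calc _ = ∫ ω, H (PP ω, ZZ ω) ∂Pr := rfl
    _ = ∫ a, H a ∂(Pr.map fun ω => (PP ω, ZZ ω)) :=
        (integral_map (hPm.prodMk hZm) hHm.aestronglyMeasurable).symm
    _ = ∫ p, ∫ z, H (p, z) ∂(Pr.map ZZ) ∂(Pr.map PP) := by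
        rw [hprod, integral_prod _ hint]
    _ = ∫ p, ∏ k ∈ T, (∫ y, u k y ∂cycleLaw ν k) ^ p k ∂(Pr.map PP) := by
        refine integral_congr_ae (.of_forall fun p => ?_)
        change ∫ z, H (p, z) ∂(Pr.map ZZ) = _
        have hHp : Measurable fun z => H (p, z) := hHm.comp measurable_prodMk_left
        rw [integral_map hZm hHp.aestronglyMeasurable]
        exact h.integral_prod_Z hu T p
    _ = ∫ ω, ∏ k ∈ T, (∫ y, u k y ∂cycleLaw ν k) ^ P k ω ∂Pr := by
        rw [integral_map hPm]
        refine (Finset.measurable_prod _ fun k _ => ?_).aestronglyMeasurable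
        exact (Measurable.of_discrete (f := fun n : ℕ => (∫ y, u k y ∂cycleLaw ν k) ^ n)).comp
          (measurable_pi_apply k)
    _ = _ := h.integral_prod_P T fun k => ∫ y, u k y ∂cycleLaw ν k

end Limit

/-! ### Measurability, convergence and characteristic function of the limit variable. -/

theorem limitBlock_zero {Ω : Type*} (F : Circle → ℂ) (P : ℕ → Ω → ℕ) (Z : ℕ → ℕ → Ω → Circle) (ω : Ω) :
    limitBlock F P Z 0 ω = 0 := by simp [limitBlock]

section LimitVariable

variable {θ : ℕ → ℝ} {r : ℝ} {ν : Measure Circle} {Ω : Type*} [MeasurableSpace Ω] {Pr : Measure Ω}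
  {P : ℕ → Ω → ℕ} {Z : ℕ → ℕ → Ω → Circle} {F : Circle → ℂ}

theorem IsLimitData.aemeasurable_limitBlock (h : IsLimitData θ r ν Pr P Z) (hF : Measurable F)
    (k : ℕ) : AEMeasurable (limitBlock F P Z k) Pr := by
  rcases Nat.eq_zero_or_pos k with rfl | hk
  · rw [funext (limitBlock_zero F P Z)]
    exact aemeasurable_const
  · exact aemeasurable_sum_range (measurable_mul_rootAverage hF k) (h.law_P k hk).aemeasurable
      fun m => (h.law_Z k m hk).aemeasurable

theorem ae_tendsto_limitVariable
    (hs : ∀ᵐ ω ∂Pr, Summable fun k : ℕ => ∑ m ∈ Finset.range (P k ω),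
      ‖(k : ℂ) * rootAverage F k (Z k m ω)‖) :
    ∀ᵐ ω ∂Pr, Tendsto (fun K => ∑ k ∈ Finset.range K, limitBlock F P Z k ω) atTop
      (𝓝 (limitVariable F P Z ω)) := by
  filter_upwards [hs] with ω hω
  exact (Summable.of_norm_bounded hω fun k => norm_sum_le _ _).hasSum.tendsto_sum_nat

theorem IsLimitData.integral_complexChar_sum [IsProbabilityMeasure Pr]
    (h : IsLimitData θ r ν Pr P Z) (hθ : ∀ k, 1 ≤ k → 0 < θ k) (hr : 0 < r) (hF : Measurable F)
    (s : ℂ) (K : ℕ) :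
    ∫ ω, complexChar s (∑ k ∈ Finset.range K, limitBlock F P Z k ω) ∂Pr =
      Complex.exp (∑ k ∈ Finset.range K,
        ((θ k / k : ℝ) : ℂ) * (cycleChar F ν k s - 1) * (r : ℂ) ^ k) := by
  have hu (k : ℕ) : Measurable fun y => complexChar s ((k : ℂ) * rootAverage F k y) :=
    (continuous_complexChar s).measurable.comp (measurable_mul_rootAverage hF k)
  have hb := h.integral_prod_blocks hu (fun k y => (norm_complexChar _ _).le)
    ((Finset.range K).subtype fun k => 1 ≤ k)
  -- The block `k = 0` contributes the factor `1`, so products over positive `k` and over `range K`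
  -- agree.
  have hfilter : ∀ g : ℕ → ℂ, g 0 = 1 → ∏ k ∈ (Finset.range K).subtype (fun k => 1 ≤ k), g k =
      ∏ k ∈ Finset.range K, g k := by
    intro g hg
    rw [Finset.prod_subtype_eq_prod_filter, Finset.prod_filter_of_ne]
    intro k _ hk
    by_contra h0
    exact hk (by rw [show k = 0 by omega, hg])
  have h1 (ω : Ω) : complexChar s (∑ k ∈ Finset.range K, limitBlock F P Z k ω) =
      ∏ k ∈ (Finset.range K).subtype (fun k => 1 ≤ k), ∏ m ∈ Finset.range (P k ω),
        complexChar s ((k : ℕ) * rootAverage F k (Z k m ω)) := by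
    rw [complexChar_sum, ← hfilter _ (by rw [limitBlock_zero, complexChar_zero])]
    refine Finset.prod_congr rfl fun k _ => ?_
    rw [limitBlock, complexChar_sum]
  simp only [h1]
  rw [hb, Complex.exp_sum, ← hfilter _ (by simp)]
  refine Finset.prod_congr rfl fun k _ => ?_
  have hpos : 0 ≤ θ k * r ^ (k : ℕ) / (k : ℕ) := by
    have := hθ k k.2
    positivity
  rw [Real.coe_toNNReal _ hpos]
  congr 1
  change _ * (cycleChar F ν k s - 1) = _
  push_cast
  ring

/-- Partial sums converge almost surely and characters have modulus one, so dominated convergence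
passes to the limit. -/
theorem IsLimitData.integral_complexChar_limitVariable [IsProbabilityMeasure Pr]
    (h : IsLimitData θ r ν Pr P Z) (hθ : ∀ k, 1 ≤ k → 0 < θ k) (hr : 0 < r) (hF : Measurable F)
    (hs : ∀ᵐ ω ∂Pr, Summable fun k : ℕ => ∑ m ∈ Finset.range (P k ω),
      ‖(k : ℂ) * rootAverage F k (Z k m ω)‖) (s : ℂ)
    (hsum : Summable fun k : ℕ =>
      ((θ k / k : ℝ) : ℂ) * (cycleChar F ν k s - 1) * (r : ℂ) ^ k) :
    ∫ ω, complexChar s (limitVariable F P Z ω) ∂Pr = Complex.exp (∑' k : ℕ,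
        ((θ k / k : ℝ) : ℂ) * (cycleChar F ν k s - 1) * (r : ℂ) ^ k) := by
  have hmeas (K : ℕ) : AEMeasurable (fun ω => ∑ k ∈ Finset.range K, limitBlock F P Z k ω) Pr :=
    Finset.aemeasurable_fun_sum _ fun k _ => h.aemeasurable_limitBlock hF k
  have h1 : Tendsto (fun K => ∫ ω, complexChar s (∑ k ∈ Finset.range K, limitBlock F P Z k ω) ∂Pr)
      atTop (𝓝 (∫ ω, complexChar s (limitVariable F P Z ω) ∂Pr)) := by
    refine tendsto_integral_of_dominated_convergence (fun _ => 1) (fun K => ?_)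
      (integrable_const 1) (fun K => .of_forall fun ω => (norm_complexChar _ _).le) ?_
    · exact ((continuous_complexChar s).measurable.comp_aemeasurable
        (hmeas K)).aestronglyMeasurable
    · filter_upwards [ae_tendsto_limitVariable hs] with ω hω
      exact ((continuous_complexChar s).tendsto _).comp hω
  simp only [h.integral_complexChar_sum hθ hr hF s] at h1
  exact tendsto_nhds_unique h1
    ((Complex.continuous_exp.tendsto _).comp hsum.hasSum.tendsto_sum_nat)

theorem IsLimitData.aemeasurable_limitVariable (h : IsLimitData θ r ν Pr P Z) (hF : Measurable F)
    (hs : ∀ᵐ ω ∂Pr, Summable fun k : ℕ => ∑ m ∈ Finset.range (P k ω),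
      ‖(k : ℂ) * rootAverage F k (Z k m ω)‖) :
    AEMeasurable (limitVariable F P Z) Pr :=
  aemeasurable_of_tendsto_metrizable_ae atTop
    (fun K => Finset.aemeasurable_fun_sum (Finset.range K) fun k _ =>
      h.aemeasurable_limitBlock hF k) (ae_tendsto_limitVariable hs)

theorem IsLimitData.ae_summable_rootAverage (h : IsLimitData θ r ν Pr P Z)
    (hθ : ∀ k, 1 ≤ k → 0 < θ k) (hF : Measurable F) {ϑ γ δ : ℝ} (hr : 0 < r) (hγ : 0 < γ)
    (hδ : 0 < δ)
    (hΔ : ∃ C : ℝ, ∀ᶠ k : ℕ in atTop, ∫⁻ y, ‖rootAverage F k y‖ₑ ∂cycleLaw ν k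
      ≤ ENNReal.ofReal (C * (k : ℝ) ^ (-1 - δ)))
    (hg : MemEF r ϑ γ (gTheta θ)) :
    ∀ᵐ ω ∂Pr, Summable fun k : ℕ => ∑ m ∈ Finset.range (P k ω),
      ‖(k : ℂ) * rootAverage F k (Z k m ω)‖ := by
  obtain ⟨C, hC⟩ := hΔ
  obtain ⟨A, hA⟩ := (gTheta_isBigO hr hγ hg).bound
  -- The mean `A / k` of `P_k`, times the factor `k`, times the bound on `E|Δ_k|`.
  have hsum : Summable fun k : ℕ => A * (C * (k : ℝ) ^ (-1 - δ)) :=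
    ((Real.summable_nat_rpow.2 (by linarith)).mul_left C).mul_left A
  refine h.ae_summable (f := fun k y => (k : ℂ) * rootAverage F k y)
    (fun k => measurable_mul_rootAverage hF k) hsum ?_
  filter_upwards [hC, hA, eventually_ge_atTop 1] with k hCk hAk hk
  have hk' : (0 : ℝ) < k := by exact_mod_cast hk
  have hpos : 0 ≤ θ k * r ^ k / k := by
    have := hθ k hk
    positivity
  rw [Real.norm_of_nonneg hpos, Real.norm_of_nonneg (by positivity)] at hAk
  have h1 : ∫⁻ y, ‖(k : ℂ) * rootAverage F k y‖ₑ ∂cycleLaw ν k =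
      ENNReal.ofReal k * ∫⁻ y, ‖rootAverage F k y‖ₑ ∂cycleLaw ν k := by
    rw [← lintegral_const_mul' _ _ ENNReal.ofReal_ne_top]
    refine lintegral_congr fun y => ?_
    rw [enorm_mul, ← ofReal_norm (k : ℂ), Complex.norm_natCast]
  have h2 : 0 ≤ A * (k : ℝ)⁻¹ := hpos.trans hAk
  calc _ ≤ ENNReal.ofReal (A * (k : ℝ)⁻¹) *
        (ENNReal.ofReal k * ENNReal.ofReal (C * (k : ℝ) ^ (-1 - δ))) := by
        rw [h1]
        gcongr
    _ = _ := by
        rw [← mul_assoc, ← ENNReal.ofReal_mul h2, ← ENNReal.ofReal_mul (by positivity)]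
        congr 1
        field_simp

end LimitVariable

/-- The real inner product of `X` and `s` in `ℂ` is `Re(s̄ X)`, so the two notions of characteristic
function agree. -/
theorem charFun_map_eq {Ω : Type*} [MeasurableSpace Ω] {μ : Measure Ω} {X : Ω → ℂ}
    (hX : AEMeasurable X μ) (s : ℂ) : charFun (μ.map X) s = ∫ ω, complexChar s (X ω) ∂μ := by
  rw [charFun_apply, integral_map hX]
  · refine integral_congr_ae (.of_forall fun ω => ?_)
    change Complex.exp (_ * Complex.I) = Complex.exp (Complex.I * _)
    rw [mul_comm, Complex.inner]
    congr 3
    simp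
  · exact (by fun_prop : Continuous fun x : ℂ =>
      Complex.exp ((inner ℝ x s : ℝ) * Complex.I)).aestronglyMeasurable

theorem tsum_gDiff (θ : ℕ → ℝ) (F : Circle → ℂ) (ν : Measure Circle) (r : ℝ) (s : ℂ) :
    (fun n : ℕ => (r : ℂ) ^ n * PowerSeries.coeff n (gDiff θ F ν s)) =
      fun k : ℕ => ((θ k / k : ℝ) : ℂ) * (cycleChar F ν k s - 1) * (r : ℂ) ^ k := by
  funext k
  rw [gDiff, PowerSeries.coeff_mk, mul_comm]

end WreathTrace

end

/-! ### The main theorem. -/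

theorem mainTheorem5 (θ : ℕ → ℝ) (hθ : ∀ k, 1 ≤ k → 0 < θ k)
    (ν : Measure Circle) [IsProbabilityMeasure ν]
    (F : Circle → ℂ) (hF : Measurable F)
    (r ϑ γ δ : ℝ) (hr : 0 < r) (hϑ : 0 ≤ ϑ) (hγ : 0 < γ) (hγ' : γ ≤ 1) (hδ : 0 < δ) (hδ' : δ ≤ 1)
    (hΔ : ∃ C : ℝ, ∀ᶠ k : ℕ in atTop,
      ∫⁻ y, ‖WreathTrace.rootAverage F k y‖ₑ ∂(WreathTrace.cycleLaw ν k)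
        ≤ ENNReal.ofReal (C * (k : ℝ) ^ (-1 - δ)))
    (hg : WreathTrace.MemEF r ϑ γ (WreathTrace.gTheta θ)) :
    (∀ s : ℂ, WreathTrace.MemEF r ϑ (min γ δ) (WreathTrace.gTrace θ F ν s)) ∧
    (∀ s : ℂ, Summable fun k : ℕ =>
      ((θ k / k : ℝ) : ℂ) * (WreathTrace.cycleChar F ν k s - 1) * (r : ℂ) ^ k) ∧
    (0 < ϑ → ∀ s : ℂ,
      (fun N : ℕ =>
        WreathTrace.charFunction (WreathTrace.wreathMeasure θ ν N)
            (fun x => WreathTrace.wreathTrace F x) s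
          - Complex.exp (∑' k : ℕ,
              ((θ k / k : ℝ) : ℂ) * (WreathTrace.cycleChar F ν k s - 1) * (r : ℂ) ^ k))
        =O[atTop] fun N : ℕ => (N : ℝ) ^ (-(min γ δ)) * Real.log N) ∧
    (∀ {Ω : Type*} [MeasurableSpace Ω] (Pr : Measure Ω) [IsProbabilityMeasure Pr]
        (P : ℕ → Ω → ℕ) (Z : ℕ → ℕ → Ω → Circle), WreathTrace.IsLimitData θ r ν Pr P Z →
      (∀ᵐ ω ∂Pr, Summable fun k : ℕ => ∑ m ∈ Finset.range (P k ω),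
        ‖(k : ℂ) * WreathTrace.rootAverage F k (Z k m ω)‖) ∧
      (0 < ϑ →
        haveI := fun N : ℕ => WreathTrace.isProbabilityMeasure_wreathMeasure hθ ν N
        TendstoInDistribution
          (fun (N : ℕ) (x : Equiv.Perm (Fin N) × (Fin N → Circle)) => WreathTrace.wreathTrace F x)
          atTop (WreathTrace.limitVariable F P Z)
          (fun N => WreathTrace.wreathMeasure θ ν N) Pr)) := by 
  have hsummable (s : ℂ) : Summable fun k : ℕ =>
      ((θ k / k : ℝ) : ℂ) * (WreathTrace.cycleChar F ν k s - 1) * (r : ℂ) ^ k := by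
    obtain ⟨C, hC⟩ := WreathTrace.exists_gDiff_bound hF ν hr hγ hδ hΔ hg s
    rw [← WreathTrace.tsum_gDiff]
    exact .of_norm_bounded ((WreathTrace.summable_polyWeight hδ).mul_left C) hC
  have hasymp (hϑ' : 0 < ϑ) (s : ℂ) : (fun N : ℕ =>
        WreathTrace.charFunction (WreathTrace.wreathMeasure θ ν N)
            (fun x => WreathTrace.wreathTrace F x) s
          - Complex.exp (∑' k : ℕ,
              ((θ k / k : ℝ) : ℂ) * (WreathTrace.cycleChar F ν k s - 1) * (r : ℂ) ^ k))
        =O[atTop] fun N : ℕ => (N : ℝ) ^ (-(min γ δ)) * Real.log N := by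
    obtain ⟨C, hC⟩ := WreathTrace.exists_gDiff_bound hF ν hr hγ hδ hΔ hg s
    have h := WreathTrace.coeff_expSeries_ratio_isBigO hr hϑ' hγ hγ' hδ hg
      (WreathTrace.constantCoeff_gTheta θ) (WreathTrace.constantCoeff_gDiff θ F ν s) hC
    rw [WreathTrace.tsum_gDiff, ← WreathTrace.gTrace_eq_add] at h
    refine h.congr_left fun N => ?_
    rw [WreathTrace.charFunction_wreathTrace_eq hθ hF]
  refine ⟨fun s => ?_, hsummable, hasymp, ?_⟩
  · obtain ⟨C, hC⟩ := WreathTrace.exists_gDiff_bound hF ν hr hγ hδ hΔ hg s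
    rw [WreathTrace.gTrace_eq_add]
    exact hg.add hr hδ hC
  intro Ω _ Pr _ P Z h
  have hs := h.ae_summable_rootAverage hθ hF hr hγ hδ hΔ hg
  refine ⟨hs, fun hϑ' => ?_⟩
  have hμ := fun N : ℕ => WreathTrace.isProbabilityMeasure_wreathMeasure hθ ν N
  have hY := h.aemeasurable_limitVariable hF hs
  refine ⟨fun N => (WreathTrace.measurable_wreathTrace hF N).aemeasurable, hY, ?_⟩
  -- Lévy's continuity theorem; the pointwise limit is the asymptotic estimate of the second claim.
  refine ProbabilityMeasure.tendsto_of_tendsto_charFun fun s => ?_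
  simp only [ProbabilityMeasure.coe_mk]
  rw [WreathTrace.charFun_map_eq hY,
    h.integral_complexChar_limitVariable hθ hr hF hs s (hsummable s)]
  have h0 := (hasymp hϑ' s).trans_tendsto
    (WreathTrace.tendsto_rpow_neg_mul_log (lt_min hγ hδ))
  have h1 := h0.add_const (Complex.exp (∑' k : ℕ,
    ((θ k / k : ℝ) : ℂ) * (WreathTrace.cycleChar F ν k s - 1) * (r : ℂ) ^ k))
  simp only [sub_add_cancel, zero_add] at h1
  refine h1.congr fun N => ?_
  exact (WreathTrace.charFun_map_eq (WreathTrace.measurable_wreathTrace hF N).aemeasurable s).symm
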